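/- Let $\mathbb{R}^m$ be equipped with an arbitrary norm $\|\cdot\|$ and let $X\subset\mathbb{R}^m$ be closed. For $Y=X$ or $Y=\mathbb{R}^m$, let $\mathcal P_1(Y)$ be the set of Borel probability measures on $Y$ with finite first moment, equipped with the $\sigma$-field generated by the maps $p\mapsto p(A)$, $A$ Borel. Let $\Phi_{1,b}(Y)$ be the set of continuous functions $\varphi:Y\to\mathbb{R}$ that are bounded from below and satisfy $|\varphi(y)|\le \alpha+\beta\|y-y_o\|$ for all $y \in Y$, for some $\alpha,\beta\ge 0$, $y_o\in Y$. Let $\theta:\mathbb{R}^m\to[0,\infty]$ be convex, and assume that - either $\theta$ is finite everywhere and there are $a>0$, $b\in\mathbb{R}$ with $\theta(x)\ge a\|x\|+b$ for all $x\in\mathbb{R}^m$, - or $\theta$ is lower semicontinuous, and $X$ is compact or a countable set of isolated points. For $\mu,\nu\in\mathcal P_1(X)$ set $$\overline{\mathcal T}_\theta(\nu|\mu)=\inf_{\pi}\int\theta\Big(x-\int y\,p_x(dy)\Big)\,\mu(dx),$$ where the infimum is over all couplings $\pi(dx\,dy)=\mu(dx)\,p_x(dy)$ of $\mu$ and $\nu$.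 This is the optimal transport cost associated with $c(x,p)=\theta(x-\int y\,p(dy))$, $x\in X$, $p\in\mathcal P_1(X)$. Then duality holds for $c$: the function $c$ is measurable on $X\times\mathcal P_1(X)$ and, for all $\mu,\nu\in\mathcal P_1(X)$, $$\overline{\mathcal T}_\theta(\nu|\mu)=\sup_{\varphi\in\Phi_{1,b}(X)}\Big\{\int R_c\varphi\,d\mu_*-\int\varphi\,d\nu\Big\},\qquad R_c\varphi(x)=\inf_{p\in\mathcal P_1(X)}\Big\{\int\varphi\,dp+c(x,p)\Big\},$$ where $\int g\,d\mu_*$ is the supremum of $\int f\,d\mu$ over bounded measurable $f\le g$. More precisely (all functions integrated with respect to $\mu$ below being measurable on $X$): 1. For all $\mu,\nu\in\mathcal P_1(X)$, $$\overline{\mathcal T}_\theta(\nu|\mu)=\sup_{\varphi\in\Phi_{1,b}(X)}\Big\{\int\overline Q_\theta\varphi\,d\mu-\int\varphi\,d\nu\Big\},\qquad \overline Q_\theta\varphi(x)=\inf_{p\in\mathcal P_1(X)}\Big\{\int\varphi\,dp+\theta\Big(x-\int y\,p(dy)\Big)\Big\},$$ and the same identity holds with $\Phi_{1,b}(X)$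 replaced by $\Phi_{1,b}(\mathbb{R}^m)$ in the supremum and $\mathcal P_1(X)$ replaced by $\mathcal P_1(\mathbb{R}^m)$ in the definition of $\overline Q_\theta\varphi$. 2. Every $\varphi\in\Phi_{1,b}(\mathbb{R}^m)$ has a greatest convex minorant $\overline\varphi:\mathbb{R}^m\to\mathbb{R}$, which belongs to $\Phi_{1,b}(\mathbb{R}^m)$, and for all $x\in\mathbb{R}^m$ $$\inf_{p\in\mathcal P_1(\mathbb{R}^m)}\Big\{\int\varphi\,dp+\theta\Big(x-\int y\,p(dy)\Big)\Big\}=Q_\theta\overline\varphi(x),\qquad\text{where } Q_\theta g(x)=\inf_{y\in\mathbb{R}^m}\{g(y)+\theta(x-y)\}.$$ 3. For all $\mu,\nu\in\mathcal P_1(X)$, $$\overline{\mathcal T}_\theta(\nu|\mu)=\sup\Big\{\int Q_\theta\varphi\,d\mu-\int\varphi\,d\nu\ ;\ \varphi:\mathbb{R}^m\to\mathbb{R}\text{ convex, Lipschitz, bounded from below}\Big\}.$$ -/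

import Mathlib

open MeasureTheory ProbabilityTheory Set
open scoped ENNReal NNReal

noncomputable section

namespace BarTransport

section General

variable {Y : Type*} [PseudoMetricSpace Y] [MeasurableSpace Y]

/-- `𝒫₁(Y)`: probability measures with a finite first moment (about some, hence any, point). -/
def P1 (Y : Type*) [PseudoMetricSpace Y] [MeasurableSpace Y] : Set (Measure Y) :=
  {μ | IsProbabilityMeasure μ ∧ ∃ x₀ : Y, ∫⁻ x, edist x x₀ ∂μ < ∞}

/-- `Φ_{1,b}(Y)`: continuous functions that are bounded from below and have at most linear
growth (about some, hence any, point). -/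
def Phi1b (Y : Type*) [PseudoMetricSpace Y] : Set (Y → ℝ) :=
  {φ | Continuous φ ∧
    (∃ a b : ℝ, 0 ≤ a ∧ 0 ≤ b ∧ ∃ x₀ : Y, ∀ x, |φ x| ≤ a + b * dist x x₀) ∧
    BddBelow (range φ)}

/-- `Π(μ, ν)`: couplings of `μ` and `ν`. -/
def couplings (μ ν : Measure Y) : Set (Measure (Y × Y)) :=
  {π | IsProbabilityMeasure π ∧ π.map Prod.fst = μ ∧ π.map Prod.snd = ν}

/-- `I_c[π] = ∫ c(x, p_x) π₁(dx)`, where `π(dx dy) = π₁(dx) p_x(dy)`. The disintegration kernel is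
unique up to a `π₁`-null set, so that the infimum is over a set of (at most) one value. -/
def costFunctional (c : Y → Measure Y → ℝ≥0∞) (π : Measure (Y × Y)) : ℝ≥0∞ :=
  ⨅ (p : Kernel Y Y) (_ : IsMarkovKernel p) (_ : (π.map Prod.fst) ⊗ₘ p = π),
    ∫⁻ x, c x (p x) ∂(π.map Prod.fst)

/-- The optimal transport cost `𝒯_c(ν | μ)`. -/
def transportCost (c : Y → Measure Y → ℝ≥0∞) (ν μ : Measure Y) : ℝ≥0∞ :=
  ⨅ π ∈ couplings μ ν, costFunctional c π

/-- `R_c φ(x) = inf_{p ∈ 𝒫₁(Y)} {∫ φ dp + c(x, p)}`. -/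
def R (c : Y → Measure Y → ℝ≥0∞) (φ : Y → ℝ) (x : Y) : EReal :=
  ⨅ p ∈ P1 Y, (((∫ y, φ y ∂p : ℝ) : EReal) + (c x p : EReal))

/-- The integral of an extended real function that is bounded from below with respect to the
inner measure of `μ`: the supremum of `∫ f dμ` over bounded measurable `f ≤ g`. -/
def innerIntegral (μ : Measure Y) (g : Y → EReal) : EReal :=
  ⨆ f ∈ {f : Y → ℝ | Measurable f ∧ (∃ C : ℝ, ∀ x, |f x| ≤ C) ∧ ∀ x, (f x : EReal) ≤ g x},
    ((∫ x, f x ∂μ : ℝ) : EReal)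

/-- The integral `∫ g⁺ dμ - ∫ g⁻ dμ` of an extended real measurable function (used for functions
that are bounded from below). -/
def eintegral (μ : Measure Y) (g : Y → EReal) : EReal :=
  ((∫⁻ x, (g x).toENNReal ∂μ : ℝ≥0∞) : EReal) - ((∫⁻ x, (-g x).toENNReal ∂μ : ℝ≥0∞) : EReal)

/-- `c` is a cost function: it is measurable on `Y × 𝒫₁(Y)`, where `𝒫₁(Y)` carries the `σ`-field
generated by the evaluations `p ↦ p(A)`, `A` measurable. Values outside `𝒫₁(Y)` are irrelevant. -/
def IsCost (c : Y → Measure Y → ℝ≥0∞) : Prop :=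
  Measurable fun q : Y × {p : Measure Y // p ∈ P1 Y} => c q.1 q.2.1

/-- Duality holds for the cost function `c` on `Y × 𝒫₁(Y)`. -/
def DualityHolds (c : Y → Measure Y → ℝ≥0∞) : Prop :=
  IsCost c ∧ ∀ μ ∈ P1 Y, ∀ ν ∈ P1 Y,
    (transportCost c ν μ : EReal) =
      ⨆ φ ∈ Phi1b Y, (innerIntegral μ (R c φ) - ((∫ y, φ y ∂ν : ℝ) : EReal))

end General

section Barycentric

variable {E : Type*} [NormedAddCommGroup E] [NormedSpace ℝ E] [MeasurableSpace E]

/-- The barycentric cost `c(x, p) = θ(x - ∫ y p(dy))` on `X × 𝒫₁(X)`. -/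
def barCost (X : Set E) (θ : E → ℝ≥0∞) (x : X) (p : Measure X) : ℝ≥0∞ :=
  θ ((x : E) - ∫ y, (y : E) ∂p)

/-- `inf_{p ∈ 𝒫₁(X)} {∫ φ dp + θ(x - ∫ y p(dy))}`, for `φ` defined on `X` and `x` in the whole
space. -/
def barQOn (X : Set E) (θ : E → ℝ≥0∞) (φ : X → ℝ) (x : E) : EReal :=
  ⨅ p ∈ P1 X, (((∫ y, φ y ∂p : ℝ) : EReal) + (θ (x - ∫ y, (y : E) ∂p) : EReal))

/-- The same infimum over all of `𝒫₁(E)`, for `φ` defined on the whole space. -/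
def barQ (θ : E → ℝ≥0∞) (φ : E → ℝ) (x : E) : EReal :=
  ⨅ p ∈ P1 E, (((∫ y, φ y ∂p : ℝ) : EReal) + (θ (x - ∫ y, y ∂p) : EReal))

/-- `Q_θ g(x) = inf_y {g(y) + θ(x - y)}`. -/
def Q (θ : E → ℝ≥0∞) (g : E → ℝ) (x : E) : EReal :=
  ⨅ y : E, ((g y : EReal) + (θ (x - y) : EReal))

/-- `h` is the greatest convex function `E → ℝ` below `φ`. -/
def IsConvexEnvelope (φ h : E → ℝ) : Prop :=
  IsGreatest {k : E → ℝ | ConvexOn ℝ univ k ∧ k ≤ φ} h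

/-- Convex, Lipschitz functions `E → ℝ` that are bounded from below. -/
def convexLipschitzBelow (E : Type*) [NormedAddCommGroup E] [NormedSpace ℝ E] : Set (E → ℝ) :=
  {φ | ConvexOn ℝ univ φ ∧ (∃ K : ℝ≥0, LipschitzWith K φ) ∧ BddBelow (range φ)}

end Barycentric

end BarTransport

end

open BarTransport

/-! Weak duality is pointwise: if `π = μ ⊗ₘ p` is a coupling, then `p x` competes in the infimum
defining `barQOn` for `μ`-almost every `x`, and integrating bounds every dual value by the cost
(`eintegral_barQOn_sub_le`). By Jensen, `Q θ φ ≤ barQOn X θ φ` for convex `φ`. Hence the identities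
on `X` reduce to one inequality: the cost is at most the supremum over convex Lipschitz functions
bounded below (`transportCost_barCost_le`).

The cost is not linear in `π`, but `θ`, convex and lower semicontinuous, is a supremum of countably
many affine functions. Along the displacement `z x = x - ∫ y dp_x`, the maximum of finitely many of
them is an a.e. limit of affine minorants `σ_x` depending continuously on `x`
(`exists_continuous_selection`), and `∫ σ_x (z x) dμ` equals the integral of `σ_x (x - y)` against
`π`, which is linear in `π`. So one coupling is sought with `∫ k dπ ≤ s D` for a convex cone of
pairs `(s, k)`, where `k (x, y) = a_x - ξ_x y` lies below `s θ (x - y)` wherever `θ (x - y)` is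
finite. The extension theorem of M. Riesz and the Riesz–Markov theorem provide it
(`exists_coupling_of_cone`) as soon as `f ⊕ h ≤ k` forces `∫ f dμ + ∫ h dν ≤ s D`. For `s > 0` the
function `φ y = sup_x (f x - a_x + ξ_x y) / s` is convex and Lipschitz, lies below `-h / s` on `X`,
and satisfies `f / s ≤ Q θ φ`; testing the dual bound on `φ` gives the claim
(`integral_add_integral_le_of_dual_bound`).

On the whole space, grouping measures by barycenter gives `barQ θ φ = Q θ (convexEnvelope φ)`
(`barQ_eq_Q`), and passing to the envelope can only raise the dual value. -/

namespace BarTransport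

open Filter Topology

/-! ### Riesz representation of tight positive functionals on functions of linear growth -/

section Representation

variable {Z : Type*}

/-- Functions of at most linear growth with respect to the weight `ρ`. -/
def growthSubmodule (ρ : Z → ℝ) : Submodule ℝ (Z → ℝ) where
  carrier := {u | ∃ C, 0 ≤ C ∧ ∀ z, |u z| ≤ C * (1 + ρ z)}
  zero_mem' := ⟨0, le_rfl, fun z => by simp⟩
  add_mem' := by
    rintro u v ⟨C, hC0, hC⟩ ⟨C', hC0', hC'⟩
    refine ⟨C + C', by positivity, fun z => (abs_add_le _ _).trans ?_⟩
    have := hC z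
    have := hC' z
    linarith
  smul_mem' := by
    rintro a u ⟨C, hC0, hC⟩
    refine ⟨|a| * C, by positivity, fun z => ?_⟩
    rw [Pi.smul_apply, smul_eq_mul, abs_mul, mul_assoc]
    exact mul_le_mul_of_nonneg_left (hC z) (abs_nonneg a)

/-- A continuous cutoff function, equal to `1` on `{ρ ≤ R}` and to `0` on `{R + 1 ≤ ρ}`. -/
noncomputable def cutoff (ρ : Z → ℝ) (R : ℝ) (z : Z) : ℝ := max 0 (min 1 (R + 1 - ρ z))

lemma cutoff_nonneg (ρ : Z → ℝ) (R : ℝ) (z : Z) : 0 ≤ cutoff ρ R z := le_max_left _ _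

lemma cutoff_le_one (ρ : Z → ℝ) (R : ℝ) (z : Z) : cutoff ρ R z ≤ 1 :=
  max_le zero_le_one (min_le_left _ _)

lemma cutoff_eq_one {ρ : Z → ℝ} {R : ℝ} {z : Z} (h : ρ z ≤ R) : cutoff ρ R z = 1 := by
  unfold cutoff
  rw [min_eq_left (by linarith), max_eq_right zero_le_one]

lemma cutoff_mono (ρ : Z → ℝ) (z : Z) : Monotone fun R => cutoff ρ R z := by
  intro R R' h
  exact max_le_max le_rfl (min_le_min le_rfl (by linarith))

lemma tendsto_cutoff (ρ : Z → ℝ) (z : Z) : Tendsto (fun n : ℕ => cutoff ρ n z) atTop (𝓝 1) := by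
  obtain ⟨N, hN⟩ := exists_nat_ge (ρ z)
  refine tendsto_const_nhds.congr' ?_
  filter_upwards [eventually_ge_atTop N] with n hn
  exact (cutoff_eq_one (hN.trans (by exact_mod_cast hn))).symm

lemma mul_cutoff_mem {ρ : Z → ℝ} {u : Z → ℝ} (hu : u ∈ growthSubmodule ρ)
    (R : ℝ) : u * cutoff ρ R ∈ growthSubmodule ρ := by
  obtain ⟨C, hC0, hC⟩ := hu
  refine ⟨C, hC0, fun z => le_trans ?_ (hC z)⟩
  rw [Pi.mul_apply, abs_mul, abs_of_nonneg (cutoff_nonneg ρ R z)]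
  exact mul_le_of_le_one_right (abs_nonneg _) (cutoff_le_one ρ R z)

variable [TopologicalSpace Z]

lemma continuous_cutoff {ρ : Z → ℝ} (hρ : Continuous ρ) (R : ℝ) : Continuous (cutoff ρ R) := by
  unfold cutoff
  fun_prop

lemma hasCompactSupport_mul_cutoff [R1Space Z] {ρ : Z → ℝ}
    (hρK : ∀ R, IsCompact {z | ρ z ≤ R}) (u : Z → ℝ) (R : ℝ) :
    HasCompactSupport (u * cutoff ρ R) := by
  refine HasCompactSupport.intro (hρK (R + 1)) fun z hz => ?_
  simp only [mem_ofPred_eq, not_le] at hz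
  have : cutoff ρ R z = 0 := by
    unfold cutoff
    exact max_eq_left ((min_le_right _ _).trans (by linarith))
  simp [this]

lemma mem_growthSubmodule_of_hasCompactSupport {ρ : Z → ℝ} (hρ : ∀ z, 0 ≤ ρ z) {u : Z → ℝ}
    (hu : Continuous u) (hc : HasCompactSupport u) : u ∈ growthSubmodule ρ := by
  obtain ⟨C, hC⟩ := hc.exists_bound_of_continuous hu
  refine ⟨|C|, abs_nonneg _, fun z => ?_⟩
  have h1 := hC z
  rw [Real.norm_eq_abs] at h1
  have h2 := le_abs_self C
  have := mul_nonneg (abs_nonneg C) (hρ z)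
  linarith

variable [T2Space Z] [LocallyCompactSpace Z] [MeasurableSpace Z] [BorelSpace Z]

/-- A positive linear functional on functions of linear growth that is tight is represented
by a measure on continuous functions. -/
theorem exists_measure_of_tight_functional {ρ : Z → ℝ} (hρ : ∀ z, 0 ≤ ρ z) (hρc : Continuous ρ)
    (hρK : ∀ R, IsCompact {z | ρ z ≤ R})
    (Λ : growthSubmodule ρ →ₗ[ℝ] ℝ) (hΛ : ∀ u, (∀ z, 0 ≤ u.1 z) → 0 ≤ Λ u)
    (htight : ∀ ε > 0, ∃ N : ℕ, ∃ e : growthSubmodule ρ, (∀ z, 0 ≤ e.1 z) ∧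
      (∀ z, (N : ℝ) < ρ z → 1 + ρ z ≤ e.1 z) ∧ Λ e ≤ ε) :
    ∃ π : Measure Z, Integrable (fun z => 1 + ρ z) π ∧
      ∀ u : growthSubmodule ρ, Continuous u.1 → ∫ z, u.1 z ∂π = Λ u := by
  have hmono : ∀ u v : growthSubmodule ρ, (∀ z, u.1 z ≤ v.1 z) → Λ u ≤ Λ v := by
    intro u v h
    have := hΛ (v - u) fun z => by simpa using h z
    rw [map_sub] at this
    linarith
  let j : CompactlySupportedContinuousMap Z ℝ →ₗ[ℝ] growthSubmodule ρ :=
    { toFun := fun f => ⟨f, mem_growthSubmodule_of_hasCompactSupport hρ f.continuous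
        f.hasCompactSupport⟩
      map_add' := fun f g => rfl
      map_smul' := fun a f => rfl }
  let L : CompactlySupportedContinuousMap Z ℝ →ₚ[ℝ] ℝ :=
    PositiveLinearMap.mk₀ (Λ ∘ₗ j) fun f hf => hΛ _ fun z => hf z
  -- Riesz–Markov controls compactly supported functions only. Cutoffs transfer the identity to
  -- functions of linear growth.
  let π := RealRMK.rieszMeasure L
  have hπ : ∀ u : growthSubmodule ρ, Continuous u.1 → ∀ n : ℕ,
      Integrable (u.1 * cutoff ρ n) π ∧
      ∫ z, (u.1 * cutoff ρ n) z ∂π = Λ ⟨u.1 * cutoff ρ n, mul_cutoff_mem u.2 n⟩ := by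
    intro u hu n
    have hc : Continuous (u.1 * cutoff ρ n) := hu.mul (continuous_cutoff hρc n)
    have hs := hasCompactSupport_mul_cutoff hρK u.1 n
    refine ⟨hc.integrable_of_hasCompactSupport hs, ?_⟩
    exact RealRMK.integral_rieszMeasure L ⟨⟨_, hc⟩, hs⟩
  let w : growthSubmodule ρ := ⟨fun z => 1 + ρ z, 1, zero_le_one, fun z => by
    rw [one_mul, abs_of_nonneg (by linarith [hρ z])]⟩
  have hwc : Continuous w.1 := by
    show Continuous fun z => 1 + ρ z
    fun_prop
  have hw0 : ∀ z, 0 ≤ w.1 z := fun z => by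
    show 0 ≤ 1 + ρ z
    linarith [hρ z]
  have hwint : Integrable w.1 π := by
    refine ⟨hwc.measurable.aestronglyMeasurable, ?_⟩
    rw [hasFiniteIntegral_iff_ofReal (ae_of_all _ hw0)]
    refine lt_of_le_of_lt ?_ (ENNReal.ofReal_lt_top (r := Λ w))
    have hlim : Tendsto (fun n : ℕ => ∫⁻ z, ENNReal.ofReal ((w.1 * cutoff ρ n) z) ∂π) atTop
        (𝓝 (∫⁻ z, ENNReal.ofReal (w.1 z) ∂π)) := by
      refine lintegral_tendsto_of_tendsto_of_monotone (fun n => ?_) (ae_of_all _ fun z => ?_)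
        (ae_of_all _ fun z => ?_)
      · exact (hwc.mul (continuous_cutoff hρc n)).measurable.ennreal_ofReal.aemeasurable
      · intro m n hmn
        refine ENNReal.ofReal_le_ofReal (mul_le_mul_of_nonneg_left ?_ (hw0 z))
        exact cutoff_mono ρ z (by exact_mod_cast hmn)
      · refine ENNReal.tendsto_ofReal ?_
        simpa using (tendsto_cutoff ρ z).const_mul (w.1 z)
    refine le_of_tendsto' hlim fun n => ?_
    rw [← ofReal_integral_eq_lintegral_ofReal (hπ w hwc n).1
      (ae_of_all _ fun z => mul_nonneg (hw0 z) (cutoff_nonneg ρ n z)), (hπ w hwc n).2]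
    refine ENNReal.ofReal_le_ofReal (hmono _ _ fun z => ?_)
    exact mul_le_of_le_one_right (hw0 z) (cutoff_le_one ρ n z)
  refine ⟨π, hwint, fun u hu => ?_⟩
  obtain ⟨C, hC0, hC⟩ := u.2
  have h1 : Tendsto (fun n : ℕ => ∫ z, (u.1 * cutoff ρ n) z ∂π) atTop (𝓝 (∫ z, u.1 z ∂π)) := by
    refine tendsto_integral_of_dominated_convergence (fun z => C * w.1 z) (fun n => ?_)
      (hwint.const_mul C) (fun n => ae_of_all _ fun z => ?_) (ae_of_all _ fun z => ?_)
    · exact (hπ u hu n).1.aestronglyMeasurable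
    · rw [Real.norm_eq_abs, Pi.mul_apply, abs_mul, abs_of_nonneg (cutoff_nonneg ρ n z)]
      exact (mul_le_of_le_one_right (abs_nonneg _) (cutoff_le_one ρ n z)).trans (hC z)
    · simpa using (tendsto_cutoff ρ z).const_mul (u.1 z)
  have h2 : Tendsto (fun n : ℕ => ∫ z, (u.1 * cutoff ρ n) z ∂π) atTop (𝓝 (Λ u)) := by
    rw [Metric.tendsto_atTop]
    intro ε hε
    -- The cutoff error of `u` vanishes on `{ρ ≤ n}` and is at most `C * (1 + ρ) ≤ C * e` elsewhere,
    -- hence `C * Λ e < ε` suffices. The `C + 1` covers `C = 0`.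
    obtain ⟨N, e, he0, he, hΛe⟩ := htight (ε / (2 * (C + 1))) (by positivity)
    refine ⟨N, fun n hn => ?_⟩
    rw [(hπ u hu n).2, Real.dist_eq]
    have key : ∀ z, |u.1 z - (u.1 * cutoff ρ n) z| ≤ C * e.1 z := by
      intro z
      rw [Pi.mul_apply]
      by_cases hz : ρ z ≤ n
      · rw [cutoff_eq_one hz, mul_one, sub_self, abs_zero]
        exact mul_nonneg hC0 (he0 z)
      · push Not at hz
        have h3 := he z (lt_of_le_of_lt (by exact_mod_cast hn) hz)
        have h4 : u.1 z - u.1 z * cutoff ρ n z = u.1 z * (1 - cutoff ρ n z) := by ring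
        rw [h4, abs_mul, abs_of_nonneg (sub_nonneg.2 (cutoff_le_one ρ n z))]
        refine (mul_le_of_le_one_right (abs_nonneg _) (by linarith [cutoff_nonneg ρ n z])).trans ?_
        exact (hC z).trans (mul_le_mul_of_nonneg_left h3 hC0)
    have h5 := hmono (u - ⟨u.1 * cutoff ρ n, mul_cutoff_mem u.2 n⟩) (C • e) fun z =>
      (le_abs_self _).trans (key z)
    have h6 := hmono (-(C • e)) (u - ⟨u.1 * cutoff ρ n, mul_cutoff_mem u.2 n⟩) fun z =>
      (abs_le.1 (key z)).1
    rw [map_neg] at h6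
    rw [map_sub, map_smul, smul_eq_mul] at h5 h6
    have h7 : C * Λ e < ε := by
      have : C * Λ e ≤ C * (ε / (2 * (C + 1))) := mul_le_mul_of_nonneg_left hΛe hC0
      have h8 : C * (ε / (2 * (C + 1))) = ε * (C / (2 * (C + 1))) := by ring
      have h9 : C / (2 * (C + 1)) < 1 := by
        rw [div_lt_one (by positivity)]
        linarith
      have : ε * (C / (2 * (C + 1))) < ε * 1 := mul_lt_mul_of_pos_left h9 hε
      linarith
    rw [abs_lt]
    constructor <;> linarith
  exact tendsto_nhds_unique h1 h2

end Representation

/-! ### Abstract Kantorovich duality through extension of positive functionals -/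

section Kantorovich

variable {Y : Type*} [TopologicalSpace Y] [T2Space Y] [LocallyCompactSpace Y]
  [SecondCountableTopology Y] [MeasurableSpace Y] [BorelSpace Y]

omit [T2Space Y] [LocallyCompactSpace Y] [SecondCountableTopology Y] in
lemma integrable_of_mem_growthSubmodule {r : Y → ℝ}
    {μ : Measure Y} [IsProbabilityMeasure μ] (hμ : Integrable r μ) {u : Y → ℝ}
    (hu : u ∈ growthSubmodule r) (hc : Continuous u) : Integrable u μ := by
  obtain ⟨C, _, hC⟩ := hu
  refine Integrable.mono' (((integrable_const (1 : ℝ)).add hμ).const_mul C)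
    hc.measurable.aestronglyMeasurable (ae_of_all _ fun z => ?_)
  simpa using hC z

omit [T2Space Y] [LocallyCompactSpace Y] [SecondCountableTopology Y] in
-- The constants are chosen for tightness of couplings: if `r x + r y > N ≥ 1`, the larger of the
-- two values, `m`, exceeds `N / 2`, so `8 * (m - N / 4) > 4 * m ≥ 1 + r x + r y`.
lemma tendsto_integral_tail {r : Y → ℝ} (hr : ∀ y, 0 ≤ r y) (hrc : Continuous r)
    {μ : Measure Y} (hμ : Integrable r μ) :
    Tendsto (fun n : ℕ => ∫ y, 8 * max 0 (r y - n / 4) ∂μ) atTop (𝓝 0) := by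
  have : Tendsto (fun n : ℕ => ∫ y, 8 * max 0 (r y - n / 4) ∂μ) atTop (𝓝 (∫ _, (0 : ℝ) ∂μ)) := by
    refine tendsto_integral_of_dominated_convergence (fun y => 8 * r y) (fun n => ?_)
      (hμ.const_mul 8) (fun n => ae_of_all _ fun y => ?_) (ae_of_all _ fun y => ?_)
    · exact Continuous.aestronglyMeasurable (by fun_prop)
    · have h1 : (0 : ℝ) ≤ max 0 (r y - n / 4) := le_max_left _ _
      have h2 : max 0 (r y - n / 4) ≤ r y :=
        max_le (hr y) (by linarith [show (0 : ℝ) ≤ (n : ℝ) / 4 by positivity])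
      rw [Real.norm_eq_abs, abs_of_nonneg (by linarith)]
      linarith
    · obtain ⟨N, hN⟩ := exists_nat_ge (4 * r y)
      refine tendsto_const_nhds.congr' ?_
      filter_upwards [eventually_ge_atTop N] with n hn
      have : (N : ℝ) ≤ n := by exact_mod_cast hn
      rw [max_eq_left (by linarith), mul_zero]
  simpa using this

/-- Abstract Kantorovich duality: let `K` be a cone of pairs `(s, k)`, where `s` is thought of as a
bound for the integral of `k` against a coupling. If `f ⊕ h ≤ k` implies `∫ f dμ + ∫ h dν ≤ s D`,
then some coupling satisfies `∫ k dπ ≤ s D` for all these pairs with `k` continuous. -/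
theorem exists_coupling_of_cone {r : Y → ℝ} (hr : ∀ y, 0 ≤ r y) (hrc : Continuous r)
    (hrK : ∀ R, IsCompact {y | r y ≤ R}) {μ ν : Measure Y} [IsProbabilityMeasure μ]
    [IsProbabilityMeasure ν] (hμ : Integrable r μ) (hν : Integrable r ν)
    (K : Submodule ℝ≥0 (ℝ × (Y × Y → ℝ))) (D : ℝ)
    (hKg : ∀ q ∈ K, q.2 ∈ growthSubmodule fun z : Y × Y => r z.1 + r z.2)
    (hK : ∀ q ∈ K, ∀ f ∈ growthSubmodule r, ∀ h ∈ growthSubmodule r, Continuous f → Continuous h →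
      (∀ x y, f x + h y ≤ q.2 (x, y)) → ∫ x, f x ∂μ + ∫ y, h y ∂ν ≤ q.1 * D) :
    ∃ π ∈ couplings μ ν, ∀ q ∈ K, Continuous q.2 →
      Integrable q.2 π ∧ ∫ z, q.2 z ∂π ≤ q.1 * D := by
  set ρ : Y × Y → ℝ := fun z => r z.1 + r z.2 with hρdef
  have hρ : ∀ z, 0 ≤ ρ z := fun z => add_nonneg (hr _) (hr _)
  have hρc : Continuous ρ := by fun_prop
  have hρK : ∀ R, IsCompact {z | ρ z ≤ R} := fun R => by
    refine ((hrK R).prod (hrK R)).of_isClosed_subset (isClosed_le hρc continuous_const) ?_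
    intro z hz
    have hz' : r z.1 + r z.2 ≤ R := hz
    refine ⟨?_, ?_⟩
    · show r z.1 ≤ R
      linarith [hr z.2]
    · show r z.2 ≤ R
      linarith [hr z.1]
  have hfst : ∀ f ∈ growthSubmodule r, (fun z : Y × Y => f z.1) ∈ growthSubmodule ρ := by
    rintro f ⟨C, hC0, hC⟩
    refine ⟨C, hC0, fun z => (hC z.1).trans (mul_le_mul_of_nonneg_left ?_ hC0)⟩
    show 1 + r z.1 ≤ 1 + (r z.1 + r z.2)
    linarith [hr z.2]
  have hsnd : ∀ f ∈ growthSubmodule r, (fun z : Y × Y => f z.2) ∈ growthSubmodule ρ := by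
    rintro f ⟨C, hC0, hC⟩
    refine ⟨C, hC0, fun z => (hC z.2).trans (mul_le_mul_of_nonneg_left ?_ hC0)⟩
    show 1 + r z.2 ≤ 1 + (r z.1 + r z.2)
    linarith [hr z.1]
  let V := growthSubmodule ρ
  -- The cone encodes all constraints on the functional `Λ` to be found as `Λ u + a ≥ 0`: if `f ⊕ h
  -- ≤ u + q.2`, then `Λ u` must be at least `∫ f dμ + ∫ h dν - q.1 * D`. Positivity, both marginals
  -- and the bounds on `K` are special cases.
  let s : PointedCone ℝ (V × ℝ) :=
    { carrier := {p | ∃ q ∈ K, ∃ f ∈ growthSubmodule r, ∃ h ∈ growthSubmodule r,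
        Continuous f ∧ Continuous h ∧ (∀ x y, f x + h y ≤ p.1.1 (x, y) + q.2 (x, y)) ∧
        q.1 * D ≤ p.2 + (∫ x, f x ∂μ + ∫ y, h y ∂ν)}
      zero_mem' := ⟨0, K.zero_mem, 0, Submodule.zero_mem _, 0, Submodule.zero_mem _,
        continuous_zero, continuous_zero, by simp, by simp⟩
      add_mem' := by
        rintro p p' ⟨q, hq, f, hf, h, hh, hfc, hhc, h1, h2⟩ ⟨q', hq', f', hf', h', hh', hfc', hhc',
          h1', h2'⟩
        refine ⟨q + q', K.add_mem hq hq', f + f', Submodule.add_mem _ hf hf', h + h',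
          Submodule.add_mem _ hh hh', hfc.add hfc', hhc.add hhc', fun x y => ?_, ?_⟩
        · have := h1 x y
          have := h1' x y
          simp only [Pi.add_apply, Prod.fst_add, Prod.snd_add, Submodule.coe_add]
          linarith
        · simp only [Pi.add_apply, Prod.fst_add, Prod.snd_add]
          rw [integral_add (integrable_of_mem_growthSubmodule hμ hf hfc)
            (integrable_of_mem_growthSubmodule hμ hf' hfc'),
            integral_add (integrable_of_mem_growthSubmodule hν hh hhc)
            (integrable_of_mem_growthSubmodule hν hh' hhc')]
          linarith
      smul_mem' := by
        rintro ⟨a, ha⟩ p ⟨q, hq, f, hf, h, hh, hfc, hhc, h1, h2⟩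
        refine ⟨(⟨a, ha⟩ : ℝ≥0) • q, K.smul_mem _ hq, a • f, Submodule.smul_mem _ _ hf, a • h,
          Submodule.smul_mem _ _ hh, hfc.const_smul a, hhc.const_smul a, fun x y => ?_, ?_⟩
        · have := mul_le_mul_of_nonneg_left (h1 x y) ha
          show a * f x + a * h y ≤ a * p.1.1 (x, y) + a * q.2 (x, y)
          linarith
        · have := mul_le_mul_of_nonneg_left h2 ha
          show a * q.1 * D ≤ a * p.2 + (∫ x, a * f x ∂μ + ∫ y, a * h y ∂ν)
          rw [integral_const_mul, integral_const_mul]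
          linarith }
  let dom : Submodule ℝ (V × ℝ) := Submodule.prod ⊥ ⊤
  let F : (V × ℝ) →ₗ.[ℝ] ℝ := ⟨dom, (LinearMap.snd ℝ V ℝ) ∘ₗ dom.subtype⟩
  obtain ⟨g, hg, hgs⟩ := riesz_extension s F
    (by
      rintro ⟨⟨u, a⟩, hu⟩ ⟨q, hq, f, hf, h, hh, hfc, hhc, h1, h2⟩
      obtain ⟨hu0, _⟩ := Submodule.mem_prod.1 hu
      simp only [Submodule.mem_bot] at hu0
      subst hu0
      have h3 := hK q hq f hf h hh hfc hhc fun x y => by simpa using h1 x y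
      show 0 ≤ a
      have h2' : q.1 * D ≤ a + (∫ x, f x ∂μ + ∫ y, h y ∂ν) := h2
      linarith)
    (by
      rintro ⟨⟨u, C, hC0, hC⟩, a⟩
      -- Since `|u| ≤ C * (1 + ρ)`, the sum of `-C * (1 + r)` in both variables lies below `u`. A
      -- large enough real component then puts the pair in the cone.
      have hf : (fun y => -C * (1 + r y)) ∈ growthSubmodule r := ⟨C, hC0, fun y => by
        rw [abs_mul, abs_neg, abs_of_nonneg hC0, abs_of_nonneg (by linarith [hr y])]⟩
      refine ⟨⟨(0, -a - ((∫ x, -C * (1 + r x) ∂μ) + ∫ y, -C * (1 + r y) ∂ν)),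
        Submodule.mem_prod.2 ⟨Submodule.zero_mem _, trivial⟩⟩, 0, K.zero_mem, _, hf, _, hf,
        by fun_prop, by fun_prop, fun x y => ?_, ?_⟩
      · have h1 := (abs_le.1 (hC (x, y))).1
        simp only [Prod.fst_add, zero_add, Prod.snd_zero, Pi.zero_apply, add_zero]
        have h2 : C * (1 + ρ (x, y)) = C + C * r x + C * r y := by
          show C * (1 + (r x + r y)) = _
          ring
        linarith
      · simp only [Prod.fst_zero, zero_mul, Prod.snd_add]
        linarith)
  let Λ : V →ₗ[ℝ] ℝ := g ∘ₗ LinearMap.inl ℝ V ℝ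
  have hgΛ : ∀ u a, g (u, a) = Λ u + a := by
    intro u a
    have h1 : g (0, a) = a := hg ⟨(0, a), Submodule.mem_prod.2 ⟨Submodule.zero_mem _, trivial⟩⟩
    have h2 : ((u, a) : V × ℝ) = (u, 0) + (0, a) := by simp
    rw [h2, map_add, h1]
    rfl
  have hΛpos : ∀ u : V, (∀ z, 0 ≤ u.1 z) → 0 ≤ Λ u := by
    intro u hu
    have := hgs (u, 0) ⟨0, K.zero_mem, 0, Submodule.zero_mem _, 0, Submodule.zero_mem _,
      continuous_zero, continuous_zero, fun x y => by simpa using hu (x, y), by simp⟩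
    rwa [hgΛ, add_zero] at this
  have hΛfst' : ∀ f (hf : f ∈ growthSubmodule r), Continuous f →
      ∫ x, f x ∂μ ≤ Λ ⟨_, hfst f hf⟩ := by
    intro f hf hfc
    have := hgs (⟨_, hfst f hf⟩, -∫ x, f x ∂μ) ⟨0, K.zero_mem, f, hf, 0, Submodule.zero_mem _,
      hfc, continuous_zero, fun x y => by simp, by simp⟩
    rw [hgΛ] at this
    linarith
  have hΛsnd' : ∀ f (hf : f ∈ growthSubmodule r), Continuous f →
      ∫ x, f x ∂ν ≤ Λ ⟨_, hsnd f hf⟩ := by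
    intro f hf hfc
    have := hgs (⟨_, hsnd f hf⟩, -∫ x, f x ∂ν) ⟨0, K.zero_mem, 0, Submodule.zero_mem _, f, hf,
      continuous_zero, hfc, fun x y => by simp, by simp⟩
    rw [hgΛ] at this
    linarith
  have hΛfst : ∀ f (hf : f ∈ growthSubmodule r), Continuous f →
      Λ ⟨_, hfst f hf⟩ = ∫ x, f x ∂μ := by
    intro f hf hfc
    refine le_antisymm ?_ (hΛfst' f hf hfc)
    -- The one-sided marginal bound, applied to `-f`, becomes an equality.
    have h1 := hΛfst' (-f) (Submodule.neg_mem _ hf) hfc.neg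
    have h2 : (⟨_, hfst (-f) (Submodule.neg_mem _ hf)⟩ : V) = -⟨_, hfst f hf⟩ := rfl
    rw [h2, map_neg] at h1
    simp only [Pi.neg_apply, integral_neg] at h1
    linarith
  have hΛsnd : ∀ f (hf : f ∈ growthSubmodule r), Continuous f →
      Λ ⟨_, hsnd f hf⟩ = ∫ x, f x ∂ν := by
    intro f hf hfc
    refine le_antisymm ?_ (hΛsnd' f hf hfc)
    have h1 := hΛsnd' (-f) (Submodule.neg_mem _ hf) hfc.neg
    have h2 : (⟨_, hsnd (-f) (Submodule.neg_mem _ hf)⟩ : V) = -⟨_, hsnd f hf⟩ := rfl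
    rw [h2, map_neg] at h1
    simp only [Pi.neg_apply, integral_neg] at h1
    linarith
  have hΛK : ∀ q (hq : q ∈ K), Λ ⟨q.2, hKg q hq⟩ ≤ q.1 * D := by
    intro q hq
    have := hgs (-⟨q.2, hKg q hq⟩, q.1 * D) ⟨q, hq, 0, Submodule.zero_mem _, 0,
      Submodule.zero_mem _, continuous_zero, continuous_zero, fun x y => by simp, by simp⟩
    rw [hgΛ, map_neg] at this
    linarith
  obtain ⟨π, hπi, hπ⟩ := exists_measure_of_tight_functional hρ hρc hρK Λ hΛpos (by
    intro ε hε
    have hlim := (tendsto_integral_tail hr hrc hμ).add (tendsto_integral_tail hr hrc hν)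
    rw [add_zero] at hlim
    obtain ⟨N, hN, hN1⟩ := ((hlim.eventually_lt_const hε).and (eventually_ge_atTop 1)).exists
    have hN1' : (1 : ℝ) ≤ N := by exact_mod_cast hN1
    have hmem : (fun y => 8 * max 0 (r y - N / 4)) ∈ growthSubmodule r := by
      refine ⟨8, by norm_num, fun y => ?_⟩
      have h1 : (0 : ℝ) ≤ max 0 (r y - N / 4) := le_max_left _ _
      have h2 : max 0 (r y - N / 4) ≤ r y := max_le (hr y) (by linarith)
      rw [abs_of_nonneg (by linarith)]
      linarith
    have hcont : Continuous (fun y => 8 * max 0 (r y - N / 4)) := by fun_prop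
    refine ⟨N, ⟨_, hfst _ hmem⟩ + ⟨_, hsnd _ hmem⟩, fun z => ?_, fun z hz => ?_, ?_⟩
    · show (0 : ℝ) ≤ 8 * max 0 (r z.1 - N / 4) + 8 * max 0 (r z.2 - N / 4)
      positivity
    · show 1 + (r z.1 + r z.2) ≤ 8 * max 0 (r z.1 - N / 4) + 8 * max 0 (r z.2 - N / 4)
      have hz' : (N : ℝ) < r z.1 + r z.2 := hz
      have h1 := le_max_left 0 (r z.1 - N / 4)
      have h2 := le_max_left 0 (r z.2 - N / 4)
      have h3 := le_max_right 0 (r z.1 - N / 4)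
      have h4 := le_max_right 0 (r z.2 - N / 4)
      rcases le_total (r z.1) (r z.2) with h | h <;> linarith
    · rw [map_add, hΛfst _ hmem hcont, hΛsnd _ hmem hcont]
      exact hN.le)
  have hπint : ∀ u ∈ growthSubmodule ρ, Continuous u → Integrable u π := by
    rintro u ⟨C, hC0, hC⟩ huc
    exact (hπi.const_mul C).mono' huc.measurable.aestronglyMeasurable (ae_of_all _ hC)
  have hone : ∀ f : Y → ℝ, (∃ C, ∀ y, |f y| ≤ C) → f ∈ growthSubmodule r := by
    rintro f ⟨C, hC⟩
    refine ⟨|C|, abs_nonneg _, fun y => ?_⟩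
    have := hC y
    have := le_abs_self C
    have := mul_nonneg (abs_nonneg C) (hr y)
    linarith
  have hπfin : IsFiniteMeasure π := by
    have h1 : Integrable (fun _ : Y × Y => (1 : ℝ)) π :=
      hπint _ (hfst (fun _ => 1) (hone _ ⟨1, fun y => by simp⟩)) continuous_const
    simpa using (integrable_const_iff.1 h1)
  have hπprob : IsProbabilityMeasure π := by
    have h0 := hone (fun _ => 1) ⟨1, fun y => by simp⟩
    have h1 := hπ ⟨_, hfst (fun _ => 1) h0⟩ continuous_const
    rw [hΛfst _ h0 continuous_const] at h1
    simp only [integral_const, smul_eq_mul, mul_one, probReal_univ] at h1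
    refine ⟨?_⟩
    rw [measureReal_def] at h1
    rw [← ENNReal.toReal_eq_one_iff]
    exact h1
  have hb : ∀ f : BoundedContinuousFunction Y ℝ, (f : Y → ℝ) ∈ growthSubmodule r :=
    fun f => hone _ ⟨‖f‖, fun y => by simpa using f.norm_coe_le_norm y⟩
  refine ⟨π, ⟨hπprob, ?_, ?_⟩, fun q hq hqc => ⟨hπint _ (hKg q hq) hqc, ?_⟩⟩
  · have : IsFiniteMeasure (π.map Prod.fst) := Measure.isFiniteMeasure_map π Prod.fst
    refine ext_of_forall_integral_eq_of_IsFiniteMeasure fun f => ?_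
    rw [integral_map measurable_fst.aemeasurable f.continuous.aestronglyMeasurable,
      ← hΛfst _ (hb f) f.continuous]
    exact hπ ⟨_, hfst _ (hb f)⟩ (f.continuous.comp continuous_fst)
  · have : IsFiniteMeasure (π.map Prod.snd) := Measure.isFiniteMeasure_map π Prod.snd
    refine ext_of_forall_integral_eq_of_IsFiniteMeasure fun f => ?_
    rw [integral_map measurable_snd.aemeasurable f.continuous.aestronglyMeasurable,
      ← hΛsnd _ (hb f) f.continuous]
    exact hπ ⟨_, hsnd _ (hb f)⟩ (f.continuous.comp continuous_snd)
  · rw [hπ ⟨q.2, hKg q hq⟩ hqc]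
    exact hΛK q hq

end Kantorovich

/-! ### Affine minorants of a convex lower semicontinuous function -/

section AffineMinorants

variable {E : Type*} [NormedAddCommGroup E] [NormedSpace ℝ E]

/-- The pairs `(ξ, c)` such that the affine function `v ↦ ξ v - c` is a minorant of `θ`. -/
def affineMinorants (θ : E → ℝ≥0∞) : Set ((E →L[ℝ] ℝ) × ℝ) :=
  {p | ∀ v, θ v ≠ ∞ → p.1 v - p.2 ≤ (θ v).toReal}

lemma zero_mem_affineMinorants (θ : E → ℝ≥0∞) : 0 ∈ affineMinorants θ := fun v _ => by simp

lemma convex_affineMinorants (θ : E → ℝ≥0∞) : Convex ℝ (affineMinorants θ) := by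
  intro p hp q hq a b ha hb hab v hv
  have h1 := mul_le_mul_of_nonneg_left (hp v hv) ha
  have h2 := mul_le_mul_of_nonneg_left (hq v hv) hb
  have h3 : (θ v).toReal = a * (θ v).toReal + b * (θ v).toReal := by rw [← add_mul, hab, one_mul]
  rw [h3]
  simp only [Prod.fst_add, Prod.smul_fst, Prod.snd_add, Prod.smul_snd, smul_eq_mul,
    add_apply, smul_apply]
  linarith

lemma convex_epigraph_ennreal {θ : E → ℝ≥0∞} (hθ : ConvexOn ℝ≥0 univ θ) :
    Convex ℝ {q : E × ℝ | 0 ≤ q.2 ∧ θ q.1 ≤ ENNReal.ofReal q.2} := by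
  rintro ⟨u, r⟩ ⟨hr, hu⟩ ⟨u', r'⟩ ⟨hr', hu'⟩ a b ha hb hab
  refine ⟨add_nonneg (mul_nonneg ha hr) (mul_nonneg hb hr'), ?_⟩
  lift a to ℝ≥0 using ha
  lift b to ℝ≥0 using hb
  have h := hθ.2 (mem_univ u) (mem_univ u') (zero_le (a := a)) (zero_le (a := b))
    (by exact_mod_cast hab)
  refine le_trans h ?_
  show a • θ u + b • θ u' ≤ ENNReal.ofReal (a * r + b * r')
  rw [ENNReal.ofReal_add (by positivity) (by positivity), ENNReal.ofReal_mul a.coe_nonneg,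
    ENNReal.ofReal_mul b.coe_nonneg, ENNReal.smul_def, ENNReal.smul_def, smul_eq_mul, smul_eq_mul,
    ENNReal.ofReal_coe_nnreal, ENNReal.ofReal_coe_nnreal]
  gcongr

/-- Hahn–Banach separates `(v, t)` from the closed convex epigraph. A non-vertical hyperplane is the
graph of the required minorant; a vertical one is handled by scaling, using `θ ≥ 0`. -/
lemma exists_affineMinorant_gt {θ : E → ℝ≥0∞} (hθ : ConvexOn ℝ≥0 univ θ)
    (hl : LowerSemicontinuous θ) {v : E} {t : ℝ} (ht0 : 0 ≤ t) (ht : ENNReal.ofReal t < θ v) :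
    ∃ p ∈ affineMinorants θ, t < p.1 v - p.2 := by
  set A : Set (E × ℝ) := {q | 0 ≤ q.2 ∧ θ q.1 ≤ ENNReal.ofReal q.2} with hA
  have hAc : IsClosed A := by
    refine (isClosed_le continuous_const continuous_snd).inter ?_
    exact hl.isClosed_epigraph.preimage
      (continuous_fst.prodMk (ENNReal.continuous_ofReal.comp continuous_snd))
  have hvA : (v, t) ∉ A := fun h => (not_le.2 ht) h.2
  obtain ⟨L, α, hL1, hL2⟩ := geometric_hahn_banach_point_closed (convex_epigraph_ennreal hθ) hAc hvA
  by_cases hfin : ∃ u, θ u ≠ ∞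
  swap
  · push Not at hfin
    exact ⟨(0, -(t + 1)), fun v hv => absurd (hfin v) hv, by simp⟩
  obtain ⟨u₀, hu₀⟩ := hfin
  set ξ : E →L[ℝ] ℝ := L.comp (ContinuousLinearMap.inl ℝ E ℝ) with hξ
  set s : ℝ := L (0, 1) with hs
  have hdec : ∀ u r, L (u, r) = ξ u + s * r := by
    intro u r
    have : ((u, r) : E × ℝ) = (u, 0) + r • (0, 1) := by simp
    rw [this, map_add, map_smul, smul_eq_mul, mul_comm r]
    rfl
  have hmem : ∀ u, θ u ≠ ∞ → (u, (θ u).toReal) ∈ A := fun u hu =>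
    ⟨ENNReal.toReal_nonneg, (ENNReal.ofReal_toReal hu).ge⟩
  -- The epigraph contains an upward half-line over `u₀`, along which a negative `s` would violate
  -- the separation.
  have hs0 : 0 ≤ s := by
    by_contra hneg
    push Not at hneg
    set r : ℝ := max (θ u₀).toReal ((α - ξ u₀) / s) with hr
    have h1 : (u₀, r) ∈ A := ⟨ENNReal.toReal_nonneg.trans (le_max_left _ _),
      (hmem u₀ hu₀).2.trans (ENNReal.ofReal_le_ofReal (le_max_left _ _))⟩
    have h2 := hL2 _ h1
    rw [hdec] at h2
    have h3 : s * r ≤ s * ((α - ξ u₀) / s) :=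
      mul_le_mul_of_nonpos_left (le_max_right _ _) hneg.le
    rw [mul_div_cancel₀ _ hneg.ne] at h3
    linarith
  rw [hdec] at hL1
  have key : ∀ u, θ u ≠ ∞ → α < ξ u + s * (θ u).toReal := fun u hu => by
    rw [← hdec]
    exact hL2 _ (hmem u hu)
  rcases hs0.eq_or_lt with h0 | hpos
  · rw [← h0, zero_mul, add_zero] at hL1
    have hgap : 0 < α - ξ v := by linarith
    -- Vertical hyperplane: `α - ξ` is negative on the domain of `θ` and positive at `v`, so every
    -- nonnegative multiple is a minorant. This multiple has value `t + 1` at `v`.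
    set κ : ℝ := (t + 1) / (α - ξ v) with hκ
    have hκ0 : 0 ≤ κ := by positivity
    refine ⟨(-(κ • ξ), -(κ * α)), fun u hu => ?_, ?_⟩
    · have h1 := key u hu
      rw [← h0, zero_mul, add_zero] at h1
      have h2 : κ * (α - ξ u) ≤ 0 := mul_nonpos_of_nonneg_of_nonpos hκ0 (by linarith)
      have h3 : (0 : ℝ) ≤ (θ u).toReal := ENNReal.toReal_nonneg
      simp only [neg_apply, smul_apply, smul_eq_mul]
      linarith
    · have h2 : κ * (α - ξ v) = t + 1 := div_mul_cancel₀ _ hgap.ne'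
      simp only [neg_apply, smul_apply, smul_eq_mul]
      linarith
  · have hval : ∀ u, (-(s⁻¹ • ξ)) u - -(s⁻¹ * α) = (α - ξ u) / s := fun u => by
      simp only [neg_apply, smul_apply, smul_eq_mul]
      field_simp
      ring
    refine ⟨(-(s⁻¹ • ξ), -(s⁻¹ * α)), fun u hu => ?_, ?_⟩
    · rw [hval, div_le_iff₀ hpos]
      linarith [key u hu]
    · rw [hval, lt_div_iff₀ hpos]
      linarith

/-- In finite dimension the space of affine functions is separable, and `t < ξ v - c` is an open
condition on `(ξ, c)`; a dense sequence of minorants therefore suffices. -/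
lemma exists_seq_affineMinorants [FiniteDimensional ℝ E] {θ : E → ℝ≥0∞}
    (hθ : ConvexOn ℝ≥0 univ θ) (hl : LowerSemicontinuous θ) :
    ∃ s : ℕ → (E →L[ℝ] ℝ) × ℝ, (∀ n, s n ∈ affineMinorants θ) ∧
      ∀ v, ∀ t : ℝ, 0 ≤ t → ENNReal.ofReal t < θ v → ∃ n, t < (s n).1 v - (s n).2 := by
  have : ProperSpace (E →L[ℝ] ℝ) := FiniteDimensional.proper ℝ _
  have : Nonempty (affineMinorants θ) := ⟨⟨0, zero_mem_affineMinorants θ⟩⟩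
  obtain ⟨s, hs⟩ := TopologicalSpace.exists_dense_seq (affineMinorants θ)
  refine ⟨fun n => s n, fun n => (s n).2, fun v t ht0 ht => ?_⟩
  obtain ⟨p, hp, hpt⟩ := exists_affineMinorant_gt hθ hl ht0 ht
  have hopen : IsOpen {q : affineMinorants θ | t < q.1.1 v - q.1.2} := by
    refine isOpen_lt continuous_const ?_
    have h1 : Continuous fun q : affineMinorants θ => q.1.1 v :=
      (ContinuousLinearMap.apply ℝ ℝ v).continuous.comp (continuous_fst.comp continuous_subtype_val)
    exact h1.sub (continuous_snd.comp continuous_subtype_val)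
  obtain ⟨n, hn⟩ := hs.exists_mem_open hopen ⟨⟨p, hp⟩, hpt⟩
  exact ⟨n, hn⟩

/-- The maximum of `0` and of the first `n` affine functions of the sequence `s`. -/
noncomputable def maxAffine (s : ℕ → (E →L[ℝ] ℝ) × ℝ) : ℕ → E → ℝ
  | 0, _ => 0
  | n + 1, v => max (maxAffine s n v) ((s n).1 v - (s n).2)

lemma continuous_maxAffine (s : ℕ → (E →L[ℝ] ℝ) × ℝ) : ∀ n, Continuous (maxAffine s n)
  | 0 => continuous_const
  | n + 1 => by
    have := continuous_maxAffine s n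
    show Continuous fun v => max (maxAffine s n v) ((s n).1 v - (s n).2)
    fun_prop

lemma monotone_maxAffine (s : ℕ → (E →L[ℝ] ℝ) × ℝ) (v : E) : Monotone fun n => maxAffine s n v :=
  monotone_nat_of_le_succ fun _ => le_max_left _ _

lemma maxAffine_nonneg (s : ℕ → (E →L[ℝ] ℝ) × ℝ) (n : ℕ) (v : E) : 0 ≤ maxAffine s n v :=
  monotone_maxAffine s v (Nat.zero_le n)

lemma le_iSup_maxAffine {θ : E → ℝ≥0∞} {s : ℕ → (E →L[ℝ] ℝ) × ℝ}
    (hs : ∀ v, ∀ t : ℝ, 0 ≤ t → ENNReal.ofReal t < θ v → ∃ n, t < (s n).1 v - (s n).2) (v : E) :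
    θ v ≤ ⨆ n, ENNReal.ofReal (maxAffine s n v) := by
  refine le_of_forall_lt fun a ha => ?_
  have hatop : a ≠ ∞ := ne_top_of_lt ha
  rw [← ENNReal.ofReal_toReal hatop] at ha ⊢
  obtain ⟨n, hn⟩ := hs v _ ENNReal.toReal_nonneg ha
  refine lt_of_lt_of_le ?_ (le_iSup _ (n + 1))
  have h1 : a.toReal < maxAffine s (n + 1) v := hn.trans_le (le_max_right _ _)
  exact (ENNReal.ofReal_lt_ofReal_iff (ENNReal.toReal_nonneg.trans_lt h1)).2 h1

end AffineMinorants

/-! ### Continuous selection of affine minorants -/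

section Selection

variable {Y : Type*} [MetricSpace Y] [MeasurableSpace Y] [BorelSpace Y]

/-- Bounded continuous functions are dense in `L¹`, a subsequence converges almost everywhere, and
clamping to `[0, 1]` preserves the limit. -/
lemma exists_continuous_tendsto_indicator (μ : Measure Y) [IsFiniteMeasure μ] {A : Set Y}
    (hA : MeasurableSet A) :
    ∃ u : ℕ → Y → ℝ, (∀ n, Continuous (u n)) ∧ (∀ n y, 0 ≤ u n y) ∧ (∀ n y, u n y ≤ 1) ∧
      ∀ᵐ y ∂μ, Tendsto (fun n => u n y) atTop (𝓝 (A.indicator 1 y)) := by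
  have hf : MemLp (A.indicator (1 : Y → ℝ)) 1 μ :=
    (memLp_const (1 : ℝ)).indicator hA
  have hex : ∀ n : ℕ, ∃ g : BoundedContinuousFunction Y ℝ,
      eLpNorm (A.indicator (1 : Y → ℝ) - (g : Y → ℝ)) 1 μ ≤ ENNReal.ofReal (1 / ((n : ℝ) + 1)) := fun n => by
    obtain ⟨g, hg, -⟩ := hf.exists_boundedContinuous_eLpNorm_sub_le ENNReal.one_ne_top
      (ε := ENNReal.ofReal (1 / ((n : ℝ) + 1)))
      (by simpa using Nat.cast_add_one_pos n)
    exact ⟨g, hg⟩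
  choose g hg using hex
  have hlim : Tendsto (fun n => eLpNorm ((g n : Y → ℝ) - A.indicator (1 : Y → ℝ)) 1 μ) atTop
      (𝓝 0) := by
    refine tendsto_of_tendsto_of_tendsto_of_le_of_le tendsto_const_nhds ?_ (fun n => zero_le)
      (fun n => ?_) (h := fun n : ℕ => ENNReal.ofReal (1 / ((n : ℝ) + 1)))
    · simpa using ENNReal.tendsto_ofReal tendsto_one_div_add_atTop_nhds_zero_nat
    · rw [eLpNorm_sub_comm]
      exact hg n
  obtain ⟨ns, -, hns⟩ := (tendstoInMeasure_of_tendsto_eLpNorm one_ne_zero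
    (fun n => (g n).continuous.aestronglyMeasurable) hf.aestronglyMeasurable
    hlim).exists_seq_tendsto_ae
  refine ⟨fun n y => max 0 (min 1 (g (ns n) y)), fun n => ?_, fun n y => le_max_left _ _,
    fun n y => max_le zero_le_one (min_le_left _ _), ?_⟩
  · have := (g (ns n)).continuous
    fun_prop
  · filter_upwards [hns] with y hy
    have h1 : Tendsto (fun n => max 0 (min 1 (g (ns n) y))) atTop
        (𝓝 (max 0 (min 1 (A.indicator (1 : Y → ℝ) y)))) :=
      tendsto_const_nhds.max (tendsto_const_nhds.min hy)
    convert h1 using 2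
    by_cases h : y ∈ A <;> simp [h]

variable {E : Type*} [NormedAddCommGroup E] [NormedSpace ℝ E] [MeasurableSpace E] [BorelSpace E]

/-- Along a measurable map `z`, the maximum of finitely many affine minorants of `θ` is an almost
everywhere limit of affine minorants which depend continuously on the base point. -/
lemma exists_continuous_selection {θ : E → ℝ≥0∞} {s : ℕ → (E →L[ℝ] ℝ) × ℝ}
    (hs : ∀ n, s n ∈ affineMinorants θ) (μ : Measure Y) [IsFiniteMeasure μ] {z : Y → E}
    (hz : Measurable z) (n : ℕ) :
    ∃ σ : ℕ → Y → (E →L[ℝ] ℝ) × ℝ, (∀ k, Continuous (σ k)) ∧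
      (∀ k y, σ k y ∈ affineMinorants θ) ∧ (∃ C, ∀ k y, ‖σ k y‖ ≤ C) ∧
      ∀ᵐ y ∂μ, Tendsto (fun k => (σ k y).1 (z y) - (σ k y).2) atTop (𝓝 (maxAffine s n (z y))) := by
  induction n with
  | zero =>
    exact ⟨fun _ _ => 0, fun _ => continuous_const, fun _ _ => zero_mem_affineMinorants θ,
      ⟨0, fun _ _ => by simp⟩, ae_of_all _ fun y => by simp [maxAffine]⟩
  | succ n ih =>
    obtain ⟨σ, hσc, hσm, ⟨C, hC⟩, hσ⟩ := ih
    have hA : MeasurableSet {y | maxAffine s n (z y) < (s n).1 (z y) - (s n).2} := by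
      refine measurableSet_lt ((continuous_maxAffine s n).measurable.comp hz) ?_
      have : Continuous fun v => (s n).1 v - (s n).2 := by fun_prop
      exact this.measurable.comp hz
    obtain ⟨u, huc, hu0, hu1, hu⟩ := exists_continuous_tendsto_indicator μ hA
    -- The weight `u k` approximates the indicator of the set where the new affine function wins.
    -- Convexity of the set of minorants keeps the interpolation inside it.
    refine ⟨fun k y => u k y • s n + (1 - u k y) • σ k y, fun k => ?_, fun k y => ?_,
      ⟨‖s n‖ + C, fun k y => ?_⟩, ?_⟩
    · exact ((huc k).smul continuous_const).add ((continuous_const.sub (huc k)).smul (hσc k))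
    · exact convex_affineMinorants θ (hs n) (hσm k y) (hu0 k y) (by linarith [hu1 k y]) (by ring)
    · refine (norm_add_le _ _).trans (add_le_add ?_ ?_)
      · rw [norm_smul, Real.norm_eq_abs, abs_of_nonneg (hu0 k y)]
        exact mul_le_of_le_one_left (norm_nonneg _) (hu1 k y)
      · rw [norm_smul, Real.norm_eq_abs, abs_of_nonneg (by linarith [hu1 k y])]
        exact (mul_le_of_le_one_left (norm_nonneg _) (by linarith [hu0 k y])).trans (hC k y)
    · filter_upwards [hσ, hu] with y hy1 hy2
      have h1 := (hy2.mul_const ((s n).1 (z y) - (s n).2)).add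
        ((tendsto_const_nhds (x := (1 : ℝ)).sub hy2).mul hy1)
      convert h1 using 2 with k
      · simp only [Prod.fst_add, Prod.smul_fst, Prod.snd_add, Prod.smul_snd, smul_eq_mul,
          add_apply, smul_apply]
        ring
      · by_cases h : maxAffine s n (z y) < (s n).1 (z y) - (s n).2
        · rw [indicator_of_mem (by exact h)]
          simp [maxAffine, max_eq_right h.le]
        · rw [indicator_of_notMem (by exact h)]
          simp [maxAffine, max_eq_left (not_lt.1 h)]

end Selection

/-! ### Integrability under a finite first moment -/

section FirstMoment

variable {Y : Type*} [PseudoMetricSpace Y] [MeasurableSpace Y] [OpensMeasurableSpace Y]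

lemma integrable_dist_of_mem_P1 {μ : Measure Y} (hμ : μ ∈ P1 Y) (x₀ : Y) :
    Integrable (fun x => dist x x₀) μ := by
  obtain ⟨hp, x₁, hx₁⟩ := hμ
  have h1 : Integrable (fun x => dist x x₁) μ := by
    refine ⟨(continuous_id.dist continuous_const).measurable.aestronglyMeasurable, ?_⟩
    rw [hasFiniteIntegral_iff_ofReal (ae_of_all _ fun _ => dist_nonneg)]
    simpa only [edist_dist] using hx₁
  refine (h1.add (integrable_const (dist x₁ x₀))).mono'
    (continuous_id.dist continuous_const).measurable.aestronglyMeasurable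
    (ae_of_all _ fun x => ?_)
  rw [Real.norm_eq_abs, abs_of_nonneg dist_nonneg]
  exact dist_triangle x x₁ x₀

lemma integrable_of_mem_Phi1b {μ : Measure Y} (hμ : μ ∈ P1 Y) {φ : Y → ℝ} (hφ : φ ∈ Phi1b Y) :
    Integrable φ μ := by
  obtain ⟨hc, ⟨a, b, -, -, x₀, h⟩, -⟩ := hφ
  have := hμ.1
  exact ((integrable_const a).add ((integrable_dist_of_mem_P1 hμ x₀).const_mul b)).mono'
    hc.measurable.aestronglyMeasurable (ae_of_all _ h)

omit [OpensMeasurableSpace Y] in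
lemma nonempty_of_mem_P1 {μ : Measure Y} (hμ : μ ∈ P1 Y) : Nonempty Y := ⟨hμ.2.choose⟩

omit [OpensMeasurableSpace Y] in
lemma mem_P1_of_integrable_dist {μ : Measure Y} [IsProbabilityMeasure μ] {x₀ : Y}
    (h : Integrable (fun x => dist x x₀) μ) : μ ∈ P1 Y := by
  refine ⟨inferInstance, x₀, ?_⟩
  have := h.2
  rw [hasFiniteIntegral_iff_ofReal (ae_of_all _ fun _ => dist_nonneg)] at this
  simpa only [edist_dist] using this

end FirstMoment

section FirstMomentNormed

variable {E : Type*} [NormedAddCommGroup E] [MeasurableSpace E] [BorelSpace E]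

lemma integrable_norm_of_mem_P1 {X : Set E} {μ : Measure X} (hμ : μ ∈ P1 X) :
    Integrable (fun x : X => ‖(x : E)‖) μ := by
  obtain ⟨x₀⟩ := nonempty_of_mem_P1 hμ
  have := hμ.1
  refine ((integrable_dist_of_mem_P1 hμ x₀).add (integrable_const ‖(x₀ : E)‖)).mono'
    (continuous_subtype_val.norm.measurable.aestronglyMeasurable) (ae_of_all _ fun x => ?_)
  rw [norm_norm]
  have h1 : dist x x₀ = ‖(x : E) - x₀‖ := by rw [Subtype.dist_eq, dist_eq_norm]
  show ‖(x : E)‖ ≤ dist x x₀ + ‖(x₀ : E)‖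
  rw [h1]
  simpa using norm_add_le ((x : E) - x₀) x₀

lemma integrable_coe_of_mem_P1 [SecondCountableTopology E] {X : Set E} {μ : Measure X}
    (hμ : μ ∈ P1 X) : Integrable (fun x : X => (x : E)) μ :=
  (integrable_norm_of_mem_P1 hμ).mono' continuous_subtype_val.measurable.aestronglyMeasurable
    (ae_of_all _ fun _ => le_rfl)

lemma integrable_id_of_mem_P1 [SecondCountableTopology E] {μ : Measure E} (hμ : μ ∈ P1 E) :
    Integrable (fun x : E => x) μ := by
  refine (integrable_dist_of_mem_P1 hμ 0).mono' continuous_id.measurable.aestronglyMeasurable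
    (ae_of_all _ fun x => ?_)
  simp

end FirstMomentNormed

/-! ### Integrals of extended real functions -/

section EIntegral

variable {Y : Type*} [MeasurableSpace Y] {μ : Measure Y}

lemma eintegral_mono_ae {g g' : Y → EReal} (h : ∀ᵐ x ∂μ, g x ≤ g' x) :
    eintegral μ g ≤ eintegral μ g' := by
  refine EReal.sub_le_sub ?_ ?_
  · exact EReal.coe_ennreal_le_coe_ennreal_iff.2
      (lintegral_mono_ae (h.mono fun x hx => EReal.toENNReal_le_toENNReal hx))
  · exact EReal.coe_ennreal_le_coe_ennreal_iff.2
      (lintegral_mono_ae (h.mono fun x hx => EReal.toENNReal_le_toENNReal (EReal.neg_le_neg_iff.2 hx)))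

lemma eintegral_mono {g g' : Y → EReal} (h : ∀ x, g x ≤ g' x) :
    eintegral μ g ≤ eintegral μ g' :=
  eintegral_mono_ae (ae_of_all _ h)

lemma eintegral_coe {f : Y → ℝ} (hf : Integrable f μ) :
    eintegral μ (fun x => (f x : EReal)) = ((∫ x, f x ∂μ : ℝ) : EReal) := by
  have h1 : ∫⁻ x, ENNReal.ofReal (f x) ∂μ ≠ ∞ :=
    (hf.lintegral_lt_top).ne
  have h2 : ∫⁻ x, ENNReal.ofReal (-f x) ∂μ ≠ ∞ :=
    (hf.neg.lintegral_lt_top).ne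
  unfold eintegral
  have h3 : ∀ x, (-(f x : EReal)).toENNReal = ENNReal.ofReal (-f x) := fun x => by
    rw [← EReal.coe_neg, EReal.toENNReal_of_ne_top (EReal.coe_ne_top _), EReal.toReal_coe]
  have h4 : ∀ x, ((f x : EReal)).toENNReal = ENNReal.ofReal (f x) := fun x => by
    rw [EReal.toENNReal_of_ne_top (EReal.coe_ne_top _), EReal.toReal_coe]
  simp only [h3, h4]
  rw [integral_eq_lintegral_pos_part_sub_lintegral_neg_part hf, EReal.coe_sub,
    EReal.coe_ennreal_toReal h1, EReal.coe_ennreal_toReal h2]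

lemma eintegral_le_of_le_add {g : Y → EReal} {a : Y → ℝ} {b : Y → ℝ≥0∞} (ha : Integrable a μ)
    (hb : AEMeasurable b μ) (h : ∀ᵐ x ∂μ, g x ≤ (a x : EReal) + (b x : EReal)) :
    eintegral μ g ≤ ((∫ x, a x ∂μ : ℝ) : EReal) + ((∫⁻ x, b x ∂μ : ℝ≥0∞) : EReal) := by
  by_cases hfin : ∫⁻ x, b x ∂μ = ∞
  · rw [hfin, EReal.coe_ennreal_top, EReal.coe_add_top]
    exact le_top
  · have hbt := ae_lt_top' hb hfin
    have hbi : Integrable (fun x => (b x).toReal) μ := integrable_toReal_of_lintegral_ne_top hb hfin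
    have h1 : eintegral μ g ≤ eintegral μ fun x => ((a x + (b x).toReal : ℝ) : EReal) := by
      refine eintegral_mono_ae ?_
      filter_upwards [h, hbt] with x hx hbx
      rwa [EReal.coe_add, EReal.coe_ennreal_toReal hbx.ne]
    refine h1.trans ?_
    rw [eintegral_coe (f := fun x => a x + (b x).toReal) (ha.add hbi), integral_add ha hbi,
      EReal.coe_add,      integral_toReal hb hbt, EReal.coe_ennreal_toReal hfin]

/-- The truncations `min g n` are bounded measurable minorants of `g`. They share its negative part,
and their positive parts increase to that of `g`, so monotone convergence applies. -/
lemma innerIntegral_eq_eintegral [IsProbabilityMeasure μ] {g : Y → EReal} (hg : Measurable g)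
    {m : ℝ} (hm : ∀ x, (m : EReal) ≤ g x) : innerIntegral μ g = eintegral μ g := by
  apply le_antisymm
  · refine iSup₂_le ?_
    rintro f ⟨hf, ⟨C, hC⟩, hfg⟩
    have hfi : Integrable f μ := (integrable_const C).mono' hf.aestronglyMeasurable
      (ae_of_all _ hC)
    rw [← eintegral_coe hfi]
    exact eintegral_mono hfg
  · set f : ℕ → Y → ℝ := fun n x => (min (g x) n).toReal with hfdef
    have hgbot : ∀ x, g x ≠ ⊥ := fun x => ((EReal.bot_lt_coe m).trans_le (hm x)).ne'
    have hfe : ∀ n x, (f n x : EReal) = min (g x) n := by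
      intro n x
      refine EReal.coe_toReal ?_ ?_
      · exact ((min_le_right _ _).trans_lt (lt_top_iff_ne_top.2 (EReal.natCast_ne_top n))).ne
      · rcases min_choice (g x) (n : EReal) with h | h <;> rw [h]
        · exact hgbot x
        · exact EReal.natCast_ne_bot n
    have hfb : ∀ n x, |f n x| ≤ |m| + n := by
      intro n x
      have h1 : f n x ≤ n := by
        have : (f n x : EReal) ≤ n := by rw [hfe]; exact min_le_right _ _
        exact_mod_cast this
      have h2 : min m n ≤ f n x := by
        have : ((min m n : ℝ) : EReal) ≤ f n x := by
          rw [hfe]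
          refine le_min (le_trans ?_ (hm x)) ?_
          · exact EReal.coe_le_coe_iff.2 (min_le_left _ _)
          · exact_mod_cast (min_le_right m (n : ℝ))
        exact EReal.coe_le_coe_iff.1 this
      have hn : (0 : ℝ) ≤ n := Nat.cast_nonneg n
      rw [abs_le]
      constructor
      · rcases le_total m n with h | h
        · rw [min_eq_left h] at h2
          linarith [neg_abs_le m]
        · rw [min_eq_right h] at h2
          linarith [abs_nonneg m]
      · linarith [abs_nonneg m]
    have hfm : ∀ n, Measurable (f n) := fun n =>
      (hg.min measurable_const).ereal_toReal
    have hfi : ∀ n, Integrable (f n) μ := fun n =>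
      (integrable_const (|m| + n)).mono' (hfm n).aestronglyMeasurable (ae_of_all _ (hfb n))
    have hle : ∀ n, eintegral μ (fun x => (f n x : EReal)) ≤ innerIntegral μ g := by
      intro n
      rw [eintegral_coe (hfi n)]
      refine le_iSup₂_of_le (f n) ⟨hfm n, ⟨_, hfb n⟩, fun x => ?_⟩ le_rfl
      rw [hfe]
      exact min_le_left _ _
    set N : ℝ≥0∞ := ∫⁻ x, (-g x).toENNReal ∂μ with hN
    have hNfin : N ≠ ∞ := by
      have : N ≤ ∫⁻ _, ENNReal.ofReal (-m) ∂μ := by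
        refine lintegral_mono fun x => ?_
        have h1 : -g x ≤ ((-m : ℝ) : EReal) := by
          rw [EReal.coe_neg]
          exact EReal.neg_le_neg_iff.2 (hm x)
        have h2 := EReal.toENNReal_le_toENNReal h1
        rwa [EReal.toENNReal_of_ne_top (EReal.coe_ne_top _), EReal.toReal_coe] at h2
      refine ne_top_of_le_ne_top ?_ this
      simp
    have hneg0 : ∀ {a : EReal}, 0 ≤ a → -a ≤ 0 := fun {a} ha => by
      rw [← neg_zero]
      exact EReal.neg_le_neg_iff.2 ha
    have hneg : ∀ n, ∫⁻ x, (-(f n x : EReal)).toENNReal ∂μ = N := by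
      intro n
      refine lintegral_congr fun x => ?_
      rw [hfe]
      rcases le_total (g x) n with h | h
      · rw [min_eq_left h]
      · rw [min_eq_right h]
        have h0 : (0 : EReal) ≤ n := by exact_mod_cast Nat.zero_le n
        rw [EReal.toENNReal_of_nonpos (hneg0 h0),
          EReal.toENNReal_of_nonpos (hneg0 (h0.trans h))]
    have hpos : ∫⁻ x, (g x).toENNReal ∂μ = ⨆ n, ∫⁻ x, ((f n x : EReal)).toENNReal ∂μ := by
      rw [← lintegral_iSup]
      · refine lintegral_congr fun x => ?_
        simp only [hfe]
        apply le_antisymm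
        · refine le_of_forall_lt fun c hc => ?_
          obtain ⟨n, hn⟩ := ENNReal.exists_nat_gt (ne_top_of_lt hc)
          refine lt_of_lt_of_le (lt_min hc hn) (le_iSup_of_le n ?_)
          rcases le_total (g x) n with h | h
          · rw [min_eq_left h]
            exact min_le_left _ _
          · rw [min_eq_right h]
            refine (min_le_right _ _).trans ?_
            have h1 : (n : EReal) = ((n : ℝ≥0∞) : EReal) := rfl
            rw [h1, EReal.toENNReal_coe]
        · exact iSup_le fun n => EReal.toENNReal_le_toENNReal (min_le_left _ _)
      · exact fun n => (hfm n).coe_real_ereal.ereal_toENNReal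
      · intro n k hnk x
        refine EReal.toENNReal_le_toENNReal ?_
        rw [hfe, hfe]
        exact min_le_min le_rfl (by exact_mod_cast hnk)
    unfold eintegral
    rw [hpos]
    have hNr : (N : EReal) = ((N.toReal : ℝ) : EReal) := (EReal.coe_ennreal_toReal hNfin).symm
    rw [← hN, hNr]
    have hle' : ∀ n, ((∫⁻ x, ((f n x : EReal)).toENNReal ∂μ : ℝ≥0∞) : EReal) ≤
        innerIntegral μ g + (N.toReal : EReal) := by
      intro n
      have := hle n
      unfold eintegral at this
      rw [hneg n, hNr] at this
      exact (EReal.sub_le_iff_le_add (Or.inl (EReal.coe_ne_bot _))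
        (Or.inl (EReal.coe_ne_top _))).1 this
    refine (EReal.sub_le_iff_le_add (Or.inl (EReal.coe_ne_bot _))
        (Or.inl (EReal.coe_ne_top _))).2 ?_
    have hinn : 0 ≤ innerIntegral μ g + (N.toReal : EReal) :=
      (EReal.coe_ennreal_nonneg _).trans (hle' 0)
    rw [← EReal.coe_toENNReal hinn, EReal.coe_ennreal_le_coe_ennreal_iff]
    refine iSup_le fun n => ?_
    rw [← EReal.coe_ennreal_le_coe_ennreal_iff, EReal.coe_toENNReal hinn]
    exact hle' n

end EIntegral

/-! ### Suprema of affine functions with bounded slopes -/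

section SupAffine

variable {E : Type*} [NormedAddCommGroup E] [NormedSpace ℝ E] {ι : Type*} [Nonempty ι]

omit [Nonempty ι] in
-- A uniform bound on slopes carries a bound at one point to every point; this makes suprema built
-- from data on `X` finite on all of `E`.
lemma bddAbove_range_affine {A : ι → ℝ} {ξ : ι → E →L[ℝ] ℝ} {L : ℝ} (hL : ∀ i, ‖ξ i‖ ≤ L)
    {y₀ : E} {B : ℝ} (hB : ∀ i, A i + ξ i y₀ ≤ B) (y : E) :
    BddAbove (range fun i => A i + ξ i y) := by
  refine ⟨B + L * ‖y - y₀‖, ?_⟩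
  rintro _ ⟨i, rfl⟩
  have h1 : ξ i y = ξ i y₀ + ξ i (y - y₀) := by rw [← map_add]; simp
  have h2 := (le_abs_self _).trans ((ξ i).le_of_opNorm_le (hL i) (y - y₀))
  have h3 := hB i
  show A i + ξ i y ≤ _
  linarith

lemma convexOn_iSup_affine {A : ι → ℝ} {ξ : ι → E →L[ℝ] ℝ}
    (hb : ∀ y, BddAbove (range fun i => A i + ξ i y)) :
    ConvexOn ℝ univ fun y => ⨆ i, (A i + ξ i y) := by
  refine ⟨convex_univ, fun x _ y _ a b ha hb' hab => ciSup_le fun i => ?_⟩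
  have h1 := mul_le_mul_of_nonneg_left (le_ciSup (hb x) i) ha
  have h2 := mul_le_mul_of_nonneg_left (le_ciSup (hb y) i) hb'
  have h3 : A i = a * A i + b * A i := by rw [← add_mul, hab, one_mul]
  simp only [map_add, map_smul, smul_eq_mul]
  linarith

lemma lipschitzWith_iSup_affine {A : ι → ℝ} {ξ : ι → E →L[ℝ] ℝ} {L : ℝ≥0} (hL : ∀ i, ‖ξ i‖ ≤ L)
    (hb : ∀ y, BddAbove (range fun i => A i + ξ i y)) :
    LipschitzWith L fun y => ⨆ i, (A i + ξ i y) := by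
  refine LipschitzWith.of_le_add_mul L fun x y => ciSup_le fun i => ?_
  have h1 : ξ i x = ξ i y + ξ i (x - y) := by rw [← map_add]; simp
  have h2 := (le_abs_self _).trans ((ξ i).le_of_opNorm_le (hL i) (x - y))
  have h3 := le_ciSup (hb y) i
  rw [dist_eq_norm]
  linarith

end SupAffine

/-! ### Comparison and restriction of test function classes -/

section Restriction

variable {E : Type*} [NormedAddCommGroup E] [NormedSpace ℝ E]

lemma convexLipschitzBelow_subset_Phi1b : convexLipschitzBelow E ⊆ Phi1b E := by
  rintro φ ⟨-, ⟨K, hK⟩, hb⟩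
  refine ⟨hK.continuous, ⟨|φ 0|, K, abs_nonneg _, K.coe_nonneg, 0, fun x => ?_⟩, hb⟩
  have h1 := hK.dist_le_mul x 0
  rw [Real.dist_eq] at h1
  have h2 : |φ x| ≤ |φ 0| + |φ x - φ 0| := by
    have := abs_add_le (φ 0) (φ x - φ 0)
    rwa [add_sub_cancel] at this
  linarith

omit [NormedSpace ℝ E] in
lemma restrict_mem_Phi1b {X : Set E} {φ : E → ℝ} (hφ : φ ∈ Phi1b E) (hX : Nonempty X) :
    (fun x : X => φ x) ∈ Phi1b X := by
  obtain ⟨hc, ⟨a, b, ha, hb, x₀, h⟩, m, hm⟩ := hφ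
  obtain ⟨y₀⟩ := hX
  refine ⟨hc.comp continuous_subtype_val,
    ⟨a + b * dist (y₀ : E) x₀, b, by positivity, hb, y₀, fun x => (h x).trans ?_⟩, m, ?_⟩
  · have := mul_le_mul_of_nonneg_left (dist_triangle (x : E) y₀ x₀) hb
    rw [Subtype.dist_eq]
    linarith
  · rintro _ ⟨x, rfl⟩
    exact hm ⟨x, rfl⟩

end Restriction

/-! ### Strong duality: construction of an optimal coupling -/

section StrongDuality

variable {E : Type*} [NormedAddCommGroup E] [NormedSpace ℝ E]

lemma coe_le_coe_add_ennreal {c d : ℝ} {t : ℝ≥0∞} (h : t ≠ ∞ → c ≤ d + t.toReal) :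
    (c : EReal) ≤ (d : EReal) + (t : EReal) := by
  by_cases ht : t = ∞
  · rw [ht, EReal.coe_ennreal_top, EReal.coe_add_top]
    exact le_top
  · rw [← EReal.coe_ennreal_toReal ht, ← EReal.coe_add]
    exact EReal.coe_le_coe_iff.2 (h ht)

/-- Pairs `(s, k)` where `k (x, y)` is affine in `y` with bounded slope and is at most
`s • θ (x - y)`. -/
def affineCostCone (X : Set E) (θ : E → ℝ≥0∞) : Submodule ℝ≥0 (ℝ × (X × X → ℝ)) where
  carrier := {q | 0 ≤ q.1 ∧ ∃ (ξ : X → E →L[ℝ] ℝ) (a : X → ℝ),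
    (∃ L : ℝ≥0, ∀ x, ‖ξ x‖ ≤ L) ∧ (∃ C : ℝ≥0, ∀ x : X, |a x| ≤ C * (1 + ‖(x : E)‖)) ∧
    (∀ (x : X) (y : E), θ (x - y) ≠ ∞ → a x - ξ x y ≤ q.1 * (θ (x - y)).toReal) ∧
    ∀ x y : X, q.2 (x, y) = a x - ξ x y}
  zero_mem' := ⟨le_rfl, 0, 0, ⟨0, by simp⟩, ⟨0, by simp⟩, by simp, by simp⟩
  add_mem' := by
    rintro q q' ⟨h0, ξ, a, ⟨L, hL⟩, ⟨C, hC⟩, hle, hq⟩ ⟨h0', ξ', a', ⟨L', hL'⟩, ⟨C', hC'⟩, hle', hq'⟩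
    refine ⟨add_nonneg h0 h0', ξ + ξ', a + a', ⟨L + L', fun x => ?_⟩, ⟨C + C', fun x => ?_⟩,
      fun x y hy => ?_, fun x y => ?_⟩
    · exact (norm_add_le _ _).trans (add_le_add (hL x) (hL' x))
    · refine (abs_add_le _ _).trans ?_
      rw [NNReal.coe_add, add_mul]
      exact add_le_add (hC x) (hC' x)
    · have := hle x y hy
      have := hle' x y hy
      simp only [Pi.add_apply, Prod.fst_add, add_apply]
      linarith
    · simp only [Pi.add_apply, Prod.snd_add, add_apply, hq, hq']
      ring
  smul_mem' := by
    rintro c q ⟨h0, ξ, a, ⟨L, hL⟩, ⟨C, hC⟩, hle, hq⟩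
    have hc := c.coe_nonneg
    refine ⟨mul_nonneg hc h0, (c : ℝ) • ξ, (c : ℝ) • a, ⟨c * L, fun x => ?_⟩, ⟨c * C, fun x => ?_⟩,
      fun x y hy => ?_, fun x y => ?_⟩
    · rw [Pi.smul_apply, norm_smul, Real.norm_eq_abs, abs_of_nonneg hc]
      exact mul_le_mul_of_nonneg_left (hL x) hc
    · rw [Pi.smul_apply, smul_eq_mul, abs_mul, abs_of_nonneg hc, NNReal.coe_mul, mul_assoc]
      exact mul_le_mul_of_nonneg_left (hC x) hc
    · have := mul_le_mul_of_nonneg_left (hle x y hy) hc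
      show c * a x - c * ξ x y ≤ c * q.1 * _
      linarith
    · show c * q.2 (x, y) = c * a x - c * ξ x y
      rw [hq]
      ring

lemma affineCostCone_growth {X : Set E} {θ : E → ℝ≥0∞} {q : ℝ × (X × X → ℝ)}
    (hq : q ∈ affineCostCone X θ) :
    q.2 ∈ growthSubmodule fun z : X × X => ‖(z.1 : E)‖ + ‖(z.2 : E)‖ := by
  obtain ⟨-, ξ, a, ⟨L, hL⟩, ⟨C, hC⟩, -, hq⟩ := hq
  refine ⟨C + L, by positivity, ?_⟩
  rintro ⟨x, y⟩
  rw [hq]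
  have h1 := (ξ x).le_of_opNorm_le (hL x) y
  rw [Real.norm_eq_abs] at h1
  have h2 := hC x
  have h3 : |a x - ξ x y| ≤ |a x| + |ξ x y| := abs_sub _ _
  have h4 : (0 : ℝ) ≤ C * ‖(y : E)‖ := by positivity
  have h5 : (0 : ℝ) ≤ L * ‖(x : E)‖ := by positivity
  have h6 : (0 : ℝ) ≤ L := L.coe_nonneg
  show _ ≤ ((C : ℝ) + L) * (1 + (‖(x : E)‖ + ‖(y : E)‖))
  linarith

variable [FiniteDimensional ℝ E] [MeasurableSpace E] [BorelSpace E]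

omit [FiniteDimensional ℝ E] in
-- This verifies the hypothesis of `exists_coupling_of_cone`: the slopes of `q.2` in `y` assemble
-- into a convex Lipschitz function on which the dual bound is tested.
lemma integral_add_integral_le_of_dual_bound {X : Set E} {θ : E → ℝ≥0∞} {μ ν : Measure X}
    (hμ : μ ∈ P1 X) (hν : ν ∈ P1 X) {D : ℝ}
    (hD : ∀ φ ∈ convexLipschitzBelow E, ∀ f : X → ℝ, Integrable f μ →
      (∀ x : X, (f x : EReal) ≤ Q θ φ x) → ∫ x, f x ∂μ ≤ D + ∫ y : X, φ y ∂ν)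
    {q : ℝ × (X × X → ℝ)} (hq : q ∈ affineCostCone X θ) {f h : X → ℝ} (hf : Integrable f μ)
    (hh : Integrable h ν) (hfh : ∀ x y, f x + h y ≤ q.2 (x, y)) :
    ∫ x, f x ∂μ + ∫ y, h y ∂ν ≤ q.1 * D := by
  have := hμ.1
  have := hν.1
  have : Nonempty X := nonempty_of_mem_P1 hμ
  obtain ⟨hq0, ξ, a, ⟨L, hL⟩, -, hle, hqeq⟩ := hq
  have hD0 : 0 ≤ D := by
    have := hD 0 ⟨convexOn_const 0 convex_univ, ⟨0, LipschitzWith.const 0⟩, ⟨0, by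
      rintro _ ⟨x, rfl⟩; exact le_rfl⟩⟩ 0 (integrable_zero _ _ _) fun x =>
        le_iInf fun y => coe_le_coe_add_ennreal fun _ => by simp
    simpa using this
  -- The argument divides by the first component, which may vanish; a positive `σ` above it is used,
  -- then `σ` decreases to `q.1`.
  have main : ∀ σ : ℝ, 0 < σ → q.1 ≤ σ → ∫ x, f x ∂μ + ∫ y, h y ∂ν ≤ σ * D := by
    intro σ hσ hqσ
    set A : X → ℝ := fun x => σ⁻¹ * (f x - a x) with hA
    set Ξ : X → E →L[ℝ] ℝ := fun x => σ⁻¹ • ξ x with hΞ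
    have hΞL : ∀ x, ‖Ξ x‖ ≤ (⟨σ⁻¹, (inv_pos.2 hσ).le⟩ * L : ℝ≥0) := fun x => by
      rw [hΞ, norm_smul, Real.norm_eq_abs, abs_of_pos (inv_pos.2 hσ)]
      exact mul_le_mul_of_nonneg_left (hL x) (inv_pos.2 hσ).le
    have hAΞ : ∀ x y : X, A x + Ξ x y ≤ -(σ⁻¹ * h y) := fun x y => by
      have h1 := hfh x y
      rw [hqeq] at h1
      have h2 : f x - a x + ξ x y ≤ -h y := by linarith
      have h3 := mul_le_mul_of_nonneg_left h2 (inv_pos.2 hσ).le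
      show σ⁻¹ * (f x - a x) + σ⁻¹ * ξ x y ≤ _
      linarith
    obtain ⟨y₀⟩ := ‹Nonempty X›
    have hb := bddAbove_range_affine hΞL (fun x => hAΞ x y₀)
    set φ : E → ℝ := fun y => ⨆ x, (A x + Ξ x y) with hφ
    have hφh : ∀ y : X, φ y ≤ -(σ⁻¹ * h y) := fun y => ciSup_le fun x => hAΞ x y
    -- `φ` may be unbounded below, so it is truncated at `-M`; dominated convergence removes `M` at
    -- the end.
    have hφM : ∀ M : ℕ, (fun y => max (φ y) (-M)) ∈ convexLipschitzBelow E := fun M =>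
      ⟨(convexOn_iSup_affine hb).sup (convexOn_const _ convex_univ),
        ⟨_, (lipschitzWith_iSup_affine hΞL hb).max_const _⟩,
        ⟨-M, by rintro _ ⟨y, rfl⟩; exact le_max_right _ _⟩⟩
    have hQ : ∀ (M : ℕ) (x : X), ((σ⁻¹ * f x : ℝ) : EReal) ≤ Q θ (fun y => max (φ y) (-M)) x := by
      intro M x
      refine le_iInf fun y => coe_le_coe_add_ennreal fun hy => ?_
      have h1 : A x + Ξ x y ≤ φ y := le_ciSup (hb y) x
      have h2 := hle x y hy
      have h3 : q.1 * (θ (x - y)).toReal ≤ σ * (θ (x - y)).toReal :=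
        mul_le_mul_of_nonneg_right hqσ ENNReal.toReal_nonneg
      have h4 := mul_le_mul_of_nonneg_left (h2.trans h3) (inv_pos.2 hσ).le
      rw [inv_mul_cancel_left₀ hσ.ne'] at h4
      have h5 : A x + Ξ x y = σ⁻¹ * f x - σ⁻¹ * (a x - ξ x y) := by
        show σ⁻¹ * (f x - a x) + σ⁻¹ * ξ x y = _
        ring
      have h6 := le_max_left (φ y) (-(M : ℝ))
      linarith
    have hhσ : Integrable (fun y => -(σ⁻¹ * h y)) ν := (hh.const_mul _).neg
    have hineq : ∀ M : ℕ, ∫ x, σ⁻¹ * f x ∂μ ≤ D + ∫ y, max (-(σ⁻¹ * h y)) (-M) ∂ν := by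
      intro M
      have hi : Integrable (fun y => max (-(σ⁻¹ * h y)) (-(M : ℝ))) ν :=
        hhσ.sup (integrable_const _)
      refine (hD _ (hφM M) _ (hf.const_mul _) (hQ M)).trans (add_le_add le_rfl ?_)
      refine integral_mono ?_ hi fun y => max_le_max (hφh y) le_rfl
      exact integrable_of_mem_Phi1b hν
        (restrict_mem_Phi1b (convexLipschitzBelow_subset_Phi1b (hφM M)) ⟨y₀⟩)
    have hlim : Tendsto (fun M : ℕ => ∫ y, max (-(σ⁻¹ * h y)) (-(M : ℝ)) ∂ν) atTop
        (𝓝 (∫ y, -(σ⁻¹ * h y) ∂ν)) := by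
      refine tendsto_integral_of_dominated_convergence (fun y => |-(σ⁻¹ * h y)|)
        (fun M => (hhσ.sup (integrable_const _)).aestronglyMeasurable) hhσ.abs
        (fun M => ae_of_all _ fun y => ?_) (ae_of_all _ fun y => ?_)
      · have hM : (0 : ℝ) ≤ M := Nat.cast_nonneg M
        rw [Real.norm_eq_abs, abs_le]
        constructor
        · exact (neg_abs_le _).trans (le_max_left _ _)
        · exact max_le (le_abs_self _) (by linarith [abs_nonneg (-(σ⁻¹ * h y))])
      · obtain ⟨N, hN⟩ := exists_nat_ge (σ⁻¹ * h y)
        refine tendsto_const_nhds.congr' ?_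
        filter_upwards [eventually_ge_atTop N] with M hM
        have : (N : ℝ) ≤ M := by exact_mod_cast hM
        rw [max_eq_left (by linarith)]
    have hfin := ge_of_tendsto' (hlim.const_add D) hineq
    rw [integral_neg, integral_const_mul, integral_const_mul] at hfin
    have h7 : σ * (σ⁻¹ * (∫ x, f x ∂μ + ∫ y, h y ∂ν)) ≤ σ * D :=
      mul_le_mul_of_nonneg_left (by linarith) hσ.le
    rwa [mul_inv_cancel_left₀ hσ.ne'] at h7
  refine le_of_forall_pos_le_add fun ε hε => ?_
  have h1 := main (q.1 + ε / (D + 1)) (by positivity) (by simp; positivity)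
  refine h1.trans ?_
  have h2 : (q.1 + ε / (D + 1)) * D = q.1 * D + ε * (D / (D + 1)) := by ring
  rw [h2]
  have h3 : D / (D + 1) ≤ 1 := by
    rw [div_le_one (by positivity)]
    linarith
  have := mul_le_mul_of_nonneg_left h3 hε.le
  linarith

/-- The selections are uniformly bounded by `C`, so `C * ‖z‖ + C` dominates and the bound passes
from continuous selections to the maximum. -/
lemma integral_maxAffine_le {X : Set E} {θ : E → ℝ≥0∞} {s : ℕ → (E →L[ℝ] ℝ) × ℝ}
    (hs : ∀ n, s n ∈ affineMinorants θ) {μ : Measure X} [IsFiniteMeasure μ] {z : X → E}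
    (hz : Measurable z) (hzi : Integrable z μ) {D : ℝ}
    (hD : ∀ σ : X → (E →L[ℝ] ℝ) × ℝ, Continuous σ → (∀ x, σ x ∈ affineMinorants θ) →
      (∃ C, ∀ x, ‖σ x‖ ≤ C) → ∫ x, ((σ x).1 (z x) - (σ x).2) ∂μ ≤ D) (n : ℕ) :
    Integrable (fun x => maxAffine s n (z x)) μ ∧ ∫ x, maxAffine s n (z x) ∂μ ≤ D := by
  obtain ⟨σ, hσc, hσm, ⟨C, hC⟩, hσ⟩ := exists_continuous_selection hs μ hz n
  have hbound : ∀ k x, ‖(σ k x).1 (z x) - (σ k x).2‖ ≤ C * ‖z x‖ + C := by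
    intro k x
    refine (norm_sub_le _ _).trans (add_le_add ?_ ?_)
    · exact (σ k x).1.le_of_opNorm_le ((norm_fst_le _).trans (hC k x)) _
    · exact (norm_snd_le _).trans (hC k x)
  have hbi : Integrable (fun x => C * ‖z x‖ + C) μ :=
    (hzi.norm.const_mul C).add (integrable_const C)
  have hmeas : ∀ k, AEStronglyMeasurable (fun x => (σ k x).1 (z x) - (σ k x).2) μ := by
    intro k
    have : ProperSpace E := FiniteDimensional.proper ℝ E
    have : ProperSpace (E →L[ℝ] ℝ) := FiniteDimensional.proper ℝ _
    have h1 : Continuous fun q : (E →L[ℝ] ℝ) × E => q.1 q.2 := by fun_prop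
    have h2 := h1.comp_aestronglyMeasurable
      (((continuous_fst.comp (hσc k)).aestronglyMeasurable (μ := μ)).prodMk hzi.1)
    exact h2.sub (continuous_snd.comp (hσc k)).aestronglyMeasurable
  have hlim : Tendsto (fun k => ∫ x, ((σ k x).1 (z x) - (σ k x).2) ∂μ) atTop
      (𝓝 (∫ x, maxAffine s n (z x) ∂μ)) :=
    tendsto_integral_of_dominated_convergence _ hmeas hbi (fun k => ae_of_all _ (hbound k)) hσ
  refine ⟨?_, le_of_tendsto' hlim fun k => hD _ (hσc k) (hσm k) ⟨C, hC k⟩⟩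
  refine hbi.mono' ((continuous_maxAffine s n).comp_aestronglyMeasurable hzi.1) ?_
  filter_upwards [hσ] with x hx
  exact le_of_tendsto' hx.norm fun k => hbound k x

/-- Strong duality for the barycentric transport cost. -/
theorem transportCost_barCost_le {X : Set E} (hX : IsClosed X) {θ : E → ℝ≥0∞}
    (hθ : ConvexOn ℝ≥0 univ θ) (hl : LowerSemicontinuous θ) {μ ν : Measure X}
    (hμ : μ ∈ P1 X) (hν : ν ∈ P1 X) {D : ℝ}
    (hD : ∀ φ ∈ convexLipschitzBelow E, ∀ f : X → ℝ, Integrable f μ →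
      (∀ x : X, (f x : EReal) ≤ Q θ φ x) → ∫ x, f x ∂μ ≤ D + ∫ y : X, φ y ∂ν) :
    transportCost (barCost X θ) ν μ ≤ ENNReal.ofReal D := by
  have : ProperSpace E := FiniteDimensional.proper ℝ E
  have : PolishSpace X := hX.polishSpace
  have : LocallyCompactSpace X := hX.isClosedEmbedding_subtypeVal.locallyCompactSpace
  have : Nonempty X := nonempty_of_mem_P1 hμ
  have := hμ.1
  have := hν.1
  have hrK : ∀ R, IsCompact {x : X | ‖(x : E)‖ ≤ R} := fun R => by
    have h1 := hX.isClosedEmbedding_subtypeVal.isCompact_preimage (isCompact_closedBall (0 : E) R)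
    convert h1 using 1
    ext x
    simp
  have hμr := integrable_norm_of_mem_P1 hμ
  have hνr := integrable_norm_of_mem_P1 hν
  obtain ⟨π, hπ, hπK⟩ := exists_coupling_of_cone (fun x : X => norm_nonneg (x : E))
    continuous_subtype_val.norm hrK hμr hνr (affineCostCone X θ) D
    (fun q hq => affineCostCone_growth hq)
    (fun q hq f hf h hh hfc hhc hfh => integral_add_integral_le_of_dual_bound hμ hν hD hq
      (integrable_of_mem_growthSubmodule hμr hf hfc)
      (integrable_of_mem_growthSubmodule hνr hh hhc) hfh)
  obtain ⟨hπp, hπ1, hπ2⟩ := hπ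
  set p : Kernel X X := π.condKernel with hp
  have hdis : π.map Prod.fst ⊗ₘ p = π := π.disintegrate p
  have hdis' : μ ⊗ₘ p = π := by rw [← hπ1, hdis]
  have hsnd : Integrable (fun q : X × X => (q.2 : E)) π := by
    have h1 := integrable_coe_of_mem_P1 hν
    rw [← hπ2] at h1
    exact h1.comp_measurable measurable_snd
  rw [← hdis'] at hsnd
  have hpi := (Measure.integrable_compProd_iff hsnd.1).1 hsnd
  have hbi : Integrable (fun x => ∫ y, (y : E) ∂p x) μ := by
    refine hpi.2.mono' (StronglyMeasurable.integral_kernel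
      continuous_subtype_val.stronglyMeasurable).aestronglyMeasurable (ae_of_all _ fun x => ?_)
    exact norm_integral_le_integral_norm _
  set z : X → E := fun x => (x : E) - ∫ y, (y : E) ∂p x with hzdef
  have hzi : Integrable z μ := (integrable_coe_of_mem_P1 hμ).sub hbi
  have hz : Measurable z := continuous_subtype_val.measurable.sub
    (StronglyMeasurable.integral_kernel continuous_subtype_val.stronglyMeasurable).measurable
  obtain ⟨s, hsm, hs⟩ := exists_seq_affineMinorants hθ hl
  have hn := integral_maxAffine_le hsm hz hzi (D := D) (by
    rintro σ hσc hσm ⟨C, hC⟩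
    have hC0 : 0 ≤ C := (norm_nonneg _).trans (hC (Classical.arbitrary X))
    -- A continuous selection gives an element of the cone with `s = 1`. Integrating in `y` against
    -- `p x` commutes with the affine map and produces its value at `z x`.
    have hmem : ((1 : ℝ), fun q : X × X => (σ q.1).1 ((q.1 : E) - q.2) - (σ q.1).2) ∈
        affineCostCone X θ := by
      refine ⟨zero_le_one, fun x => (σ x).1, fun x => (σ x).1 x - (σ x).2,
        ⟨⟨C, hC0⟩, fun x => (norm_fst_le _).trans (hC x)⟩, ⟨⟨C, hC0⟩, fun x => ?_⟩,
        fun x y hy => ?_, fun x y => ?_⟩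
      · have h1 := (σ x).1.le_of_opNorm_le ((norm_fst_le _).trans (hC x)) x
        have h2 := (norm_snd_le _).trans (hC x)
        have h3 := norm_sub_le ((σ x).1 x) (σ x).2
        rw [← Real.norm_eq_abs]
        show _ ≤ C * (1 + ‖(x : E)‖)
        linarith
      · have := hσm x _ hy
        rw [map_sub] at this
        linarith
      · simp only [map_sub]
        ring
    have hcont : Continuous fun q : X × X => (σ q.1).1 ((q.1 : E) - q.2) - (σ q.1).2 := by
      fun_prop
    obtain ⟨hint, hle⟩ := hπK _ hmem hcont
    rw [one_mul] at hle
    refine le_of_eq_of_le ?_ hle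
    rw [← hdis'] at hint ⊢
    rw [Measure.integral_compProd hint]
    refine integral_congr_ae ?_
    filter_upwards [hpi.1] with x hx
    have h1 : Integrable (fun y : X => (σ x).1 ((x : E) - y)) (p x) :=
      (σ x).1.integrable_comp ((integrable_const _).sub hx)
    have h2 : ∫ y, (σ x).1 ((x : E) - y) ∂p x = (σ x).1 (∫ y, ((x : E) - y) ∂p x) :=
      (σ x).1.integral_comp_comm ((integrable_const _).sub hx)
    rw [integral_sub h1 (integrable_const _), h2, integral_sub (integrable_const _) hx]
    simp [hzdef])
  refine (iInf₂_le π ⟨hπp, hπ1, hπ2⟩).trans ?_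
  refine (iInf_le _ p).trans ((iInf_le _ (inferInstance : IsMarkovKernel p)).trans ((iInf_le _ hdis).trans ?_))
  rw [hπ1]
  calc ∫⁻ x, barCost X θ x (p x) ∂μ
      ≤ ∫⁻ x, ⨆ n, ENNReal.ofReal (maxAffine s n (z x)) ∂μ :=
        lintegral_mono fun x => le_iSup_maxAffine hs (z x)
    _ = ⨆ n, ∫⁻ x, ENNReal.ofReal (maxAffine s n (z x)) ∂μ := by
        refine lintegral_iSup (fun n => ?_) fun n m hnm x => ?_
        · exact ((continuous_maxAffine s n).measurable.comp hz).ennreal_ofReal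
        · exact ENNReal.ofReal_le_ofReal (monotone_maxAffine s (z x) hnm)
    _ ≤ ENNReal.ofReal D := by
        refine iSup_le fun n => ?_
        rw [← ofReal_integral_eq_lintegral_ofReal (hn n).1
          (ae_of_all _ fun x => maxAffine_nonneg s n _)]
        exact ENNReal.ofReal_le_ofReal (hn n).2

end StrongDuality

/-! ### Lipschitz bounds and Jensen's inequality for convex functions -/

section ConvexFunctions

variable {E : Type*} [NormedAddCommGroup E] [NormedSpace ℝ E]

/-- A convex function of at most linear growth is Lipschitz. -/
lemma lipschitzWith_of_convexOn_of_le {f : E → ℝ} (hf : ConvexOn ℝ univ f) {a : ℝ} {b : ℝ≥0}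
    {x₀ : E} (h : ∀ x, f x ≤ a + b * dist x x₀) : LipschitzWith b f := by
  refine LipschitzWith.of_le_add_mul b fun x y => ?_
  have key : ∀ n : ℕ, f x ≤ f y + b * dist x y +
      (a + b * dist y x₀ - f y) * (1 / ((n : ℝ) + 1)) := by
    intro n
    set t : ℝ := (n : ℝ) + 1 with ht
    have ht0 : 0 < t := by positivity
    have hs1 : 1 / t ≤ 1 := by
      rw [div_le_one ht0, ht]
      linarith [show (0 : ℝ) ≤ n from Nat.cast_nonneg n]
    -- `z` lies far out on the ray from `y` through `x`, and `x` is a convex combination of `y` and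
    -- `z` with weight `1 / t` on `z`. As `t` grows only the linear growth rate `b` survives.
    set z : E := y + t • (x - y) with hz
    have hx : (1 - 1 / t) • y + (1 / t) • z = x := by
      rw [hz, smul_add, smul_smul, one_div_mul_cancel ht0.ne', one_smul, sub_smul, one_smul]
      abel
    have h1 := hf.2 (mem_univ y) (mem_univ z) (sub_nonneg.2 hs1) (one_div_pos.2 ht0).le (by ring)
    rw [hx, smul_eq_mul, smul_eq_mul] at h1
    have h2 : dist z x₀ ≤ t * dist x y + dist y x₀ := by
      refine (dist_triangle z y x₀).trans (add_le_add (le_of_eq ?_) le_rfl)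
      rw [dist_eq_norm, hz, add_sub_cancel_left, norm_smul, Real.norm_eq_abs, abs_of_pos ht0,
        dist_eq_norm]
    have h3 : f z ≤ a + b * (t * dist x y + dist y x₀) :=
      (h z).trans (add_le_add le_rfl (mul_le_mul_of_nonneg_left h2 b.coe_nonneg))
    have h4 := mul_le_mul_of_nonneg_left h3 (one_div_pos.2 ht0).le
    have h5 : 1 / t * (a + b * (t * dist x y + dist y x₀)) =
        b * dist x y + 1 / t * (a + b * dist y x₀) := by
      field_simp
      ring
    rw [h5] at h4
    linarith
  have hlim : Tendsto (fun n : ℕ => f y + b * dist x y +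
      (a + b * dist y x₀ - f y) * (1 / ((n : ℝ) + 1))) atTop
      (𝓝 (f y + b * dist x y + (a + b * dist y x₀ - f y) * 0)) :=
    (tendsto_one_div_add_atTop_nhds_zero_nat.const_mul _).const_add _
  rw [mul_zero, add_zero] at hlim
  exact ge_of_tendsto' hlim key

variable [FiniteDimensional ℝ E]

lemma continuous_of_convexOn_univ {f : E → ℝ} (hf : ConvexOn ℝ univ f) : Continuous f :=
  hf.locallyLipschitz.continuous

/-- Jensen's inequality, with `k ∘ g` integrable because it lies between an affine function of `g`
and `φ`. -/
lemma map_integral_le_of_convexOn {Ω : Type*} [MeasurableSpace Ω] {p : Measure Ω}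
    [IsProbabilityMeasure p] {g : Ω → E} (hg : Integrable g p) {k : E → ℝ}
    (hk : ConvexOn ℝ univ k) {φ : Ω → ℝ} (hφ : Integrable φ p) (hkφ : ∀ ω, k (g ω) ≤ φ ω) :
    k (∫ ω, g ω ∂p) ≤ ∫ ω, φ ω ∂p := by
  have hkc := continuous_of_convexOn_univ hk
  obtain ⟨l, c, hlc, -⟩ := hk.exists_affine_le_of_lt (𝕜 := ℝ) (mem_univ (0 : E))
    (sub_one_lt (k 0)) isClosed_univ (hkc.lowerSemicontinuous.lowerSemicontinuousOn _)
  have hlc' : ∀ x, l x + c ≤ k x := fun x => hlc ⟨x, mem_univ x⟩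
  have hki : Integrable (k ∘ g) p := by
    refine Integrable.mono' (((l.integrable_comp hg).add (integrable_const c)).abs.add hφ.abs)
      (hkc.comp_aestronglyMeasurable hg.1) (ae_of_all _ fun ω => ?_)
    have h1 := hlc' (g ω)
    have h2 := hkφ ω
    have h3 := neg_abs_le (l (g ω) + c)
    have h4 := le_abs_self (φ ω)
    have h5 := abs_nonneg (φ ω)
    have h6 := abs_nonneg (l (g ω) + c)
    show |k (g ω)| ≤ |l (g ω) + c| + |φ ω|
    rw [abs_le]
    constructor <;> linarith
  refine (hk.map_integral_le hkc.continuousOn isClosed_univ (ae_of_all _ fun _ => mem_univ _) hg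
    hki).trans (integral_mono hki hφ hkφ)

end ConvexFunctions

/-! ### The convex envelope as an infimum over measures with given barycenter -/

section Envelope

variable {E : Type*} [NormedAddCommGroup E] [NormedSpace ℝ E] [MeasurableSpace E]

/-- The infimum of `∫ φ dp` over the measures `p` with a given barycenter. -/
noncomputable def convexEnvelope (φ : E → ℝ) (y : E) : ℝ :=
  sInf {t | ∃ p ∈ P1 E, ∫ x, x ∂p = y ∧ ∫ x, φ x ∂p = t}

lemma dirac_mem_P1 {Y : Type*} [PseudoMetricSpace Y] [MeasurableSpace Y] [OpensMeasurableSpace Y]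
    (y : Y) : Measure.dirac y ∈ P1 Y := by
  refine ⟨inferInstance, y, ?_⟩
  rw [lintegral_dirac' _ (by fun_prop)]
  simp

variable [FiniteDimensional ℝ E] [BorelSpace E]

omit [NormedSpace ℝ E] [FiniteDimensional ℝ E] in
lemma le_integral_of_le {φ : E → ℝ} (hφ : φ ∈ Phi1b E) {m : ℝ} (hm : ∀ x, m ≤ φ x)
    {p : Measure E} (hp : p ∈ P1 E) : m ≤ ∫ x, φ x ∂p := by
  have := hp.1
  have h1 := integral_mono (integrable_const m) (integrable_of_mem_Phi1b hp hφ) hm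
  simpa using h1

omit [FiniteDimensional ℝ E] in
lemma bddBelow_convexEnvelope {φ : E → ℝ} (hφ : φ ∈ Phi1b E) (y : E) :
    BddBelow {t | ∃ p ∈ P1 E, ∫ x, x ∂p = y ∧ ∫ x, φ x ∂p = t} := by
  obtain ⟨m, hm⟩ := hφ.2.2
  refine ⟨m, ?_⟩
  rintro _ ⟨p, hp, -, rfl⟩
  exact le_integral_of_le hφ (fun x => hm ⟨x, rfl⟩) hp

omit [FiniteDimensional ℝ E] in
lemma convexEnvelope_le_integral {φ : E → ℝ} (hφ : φ ∈ Phi1b E) {p : Measure E} (hp : p ∈ P1 E) :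
    convexEnvelope φ (∫ x, x ∂p) ≤ ∫ x, φ x ∂p :=
  csInf_le (bddBelow_convexEnvelope hφ _) ⟨p, hp, rfl, rfl⟩

lemma nonempty_convexEnvelope (φ : E → ℝ) (y : E) :
    {t | ∃ p ∈ P1 E, ∫ x, x ∂p = y ∧ ∫ x, φ x ∂p = t}.Nonempty :=
  ⟨_, Measure.dirac y, dirac_mem_P1 y, integral_dirac _ y, rfl⟩

lemma exists_integral_lt_of_convexEnvelope_lt {φ : E → ℝ} {y : E} {c : ℝ}
    (h : convexEnvelope φ y < c) : ∃ p ∈ P1 E, ∫ x, x ∂p = y ∧ ∫ x, φ x ∂p < c := by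
  obtain ⟨_, ⟨p, hp, hpy, rfl⟩, hlt⟩ := exists_lt_of_csInf_lt (nonempty_convexEnvelope φ y) h
  exact ⟨p, hp, hpy, hlt⟩

lemma convexEnvelope_le {φ : E → ℝ} (hφ : φ ∈ Phi1b E) : convexEnvelope φ ≤ φ := fun y => by
  have h1 := convexEnvelope_le_integral hφ (dirac_mem_P1 y)
  rwa [integral_dirac, integral_dirac] at h1

lemma integral_convexCombination {Ω F : Type*} [MeasurableSpace Ω] [NormedAddCommGroup F]
    [NormedSpace ℝ F] {f : Ω → F} {p p' : Measure Ω} {a b : ℝ} (ha : 0 ≤ a) (hb : 0 ≤ b) (hf : Integrable f p)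
    (hf' : Integrable f p') :
    Integrable f (ENNReal.ofReal a • p + ENNReal.ofReal b • p') ∧
      ∫ x, f x ∂(ENNReal.ofReal a • p + ENNReal.ofReal b • p') =
        a • ∫ x, f x ∂p + b • ∫ x, f x ∂p' := by
  have h1 := hf.smul_measure (c := ENNReal.ofReal a) ENNReal.ofReal_ne_top
  have h2 := hf'.smul_measure (c := ENNReal.ofReal b) ENNReal.ofReal_ne_top
  refine ⟨h1.add_measure h2, ?_⟩
  rw [integral_add_measure h1 h2, integral_smul_measure, integral_smul_measure,
    ENNReal.toReal_ofReal ha, ENNReal.toReal_ofReal hb]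

/-- Mixing near-optimal measures for `y` and `y'` gives a competitor at the mixed barycenter. -/
lemma convexOn_convexEnvelope {φ : E → ℝ} (hφ : φ ∈ Phi1b E) :
    ConvexOn ℝ univ (convexEnvelope φ) := by
  refine ⟨convex_univ, fun y _ y' _ a b ha hb hab => ?_⟩
  refine le_of_forall_pos_le_add fun ε hε => ?_
  obtain ⟨p, hp, hpy, hpε⟩ := exists_integral_lt_of_convexEnvelope_lt
    (lt_add_of_pos_right (convexEnvelope φ y) hε)
  obtain ⟨p', hp', hpy', hpε'⟩ := exists_integral_lt_of_convexEnvelope_lt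
    (lt_add_of_pos_right (convexEnvelope φ y') hε)
  have := hp.1
  have := hp'.1
  have hprob : IsProbabilityMeasure (ENNReal.ofReal a • p + ENNReal.ofReal b • p') := by
    refine ⟨?_⟩
    simp only [Measure.add_apply, Measure.smul_apply, measure_univ, smul_eq_mul, mul_one]
    rw [← ENNReal.ofReal_add ha hb, hab, ENNReal.ofReal_one]
  have hmem : ENNReal.ofReal a • p + ENNReal.ofReal b • p' ∈ P1 E :=
    mem_P1_of_integrable_dist (integral_convexCombination ha hb (integrable_dist_of_mem_P1 hp 0)
      (integrable_dist_of_mem_P1 hp' 0)).1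
  have h1 := convexEnvelope_le_integral hφ hmem
  rw [(integral_convexCombination ha hb (integrable_id_of_mem_P1 hp) (integrable_id_of_mem_P1 hp')).2, hpy, hpy',
    (integral_convexCombination ha hb (integrable_of_mem_Phi1b hp hφ) (integrable_of_mem_Phi1b hp' hφ)).2] at h1
  refine h1.trans ?_
  simp only [smul_eq_mul]
  have h2 := mul_le_mul_of_nonneg_left hpε.le ha
  have h3 := mul_le_mul_of_nonneg_left hpε'.le hb
  have h4 : ε = a * ε + b * ε := by rw [← add_mul, hab, one_mul]
  linarith

lemma isConvexEnvelope_convexEnvelope {φ : E → ℝ} (hφ : φ ∈ Phi1b E) :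
    IsConvexEnvelope φ (convexEnvelope φ) := by
  refine ⟨⟨convexOn_convexEnvelope hφ, convexEnvelope_le hφ⟩, ?_⟩
  rintro k ⟨hk, hkφ⟩ y
  refine le_csInf (nonempty_convexEnvelope φ y) ?_
  rintro _ ⟨p, hp, rfl, rfl⟩
  have := hp.1
  exact map_integral_le_of_convexOn (integrable_id_of_mem_P1 hp) hk (integrable_of_mem_Phi1b hp hφ)
    hkφ

/-- The envelope inherits the linear upper bound of `φ`, and a convex function with such a bound is
Lipschitz. -/
lemma convexEnvelope_mem {φ : E → ℝ} (hφ : φ ∈ Phi1b E) :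
    convexEnvelope φ ∈ convexLipschitzBelow E := by
  refine ⟨convexOn_convexEnvelope hφ, ?_, ?_⟩
  · have hφ' := hφ
    obtain ⟨-, ⟨a, b, -, hb, x₀, h⟩, -⟩ := hφ'
    exact ⟨⟨b, hb⟩, lipschitzWith_of_convexOn_of_le (convexOn_convexEnvelope hφ) fun x =>
      (convexEnvelope_le hφ x).trans ((le_abs_self _).trans (h x))⟩
  · obtain ⟨m, hm⟩ := hφ.2.2
    refine ⟨m, ?_⟩
    rintro _ ⟨y, rfl⟩
    refine le_csInf (nonempty_convexEnvelope φ y) ?_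
    rintro _ ⟨p, hp, -, rfl⟩
    exact le_integral_of_le hφ (fun x => hm ⟨x, rfl⟩) hp

lemma convexEnvelope_eq_self {φ : E → ℝ} (hφ : φ ∈ convexLipschitzBelow E) :
    convexEnvelope φ = φ :=
  le_antisymm (convexEnvelope_le (convexLipschitzBelow_subset_Phi1b hφ))
    ((isConvexEnvelope_convexEnvelope (convexLipschitzBelow_subset_Phi1b hφ)).2 ⟨hφ.1, le_rfl⟩)

/-- The cost depends on `p` only through its barycenter `y`: minimizing first over `p` with `y`
fixed yields the envelope, then over `y` yields `Q`. -/
lemma barQ_eq_Q (θ : E → ℝ≥0∞) {φ : E → ℝ} (hφ : φ ∈ Phi1b E) (x : E) :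
    barQ θ φ x = Q θ (convexEnvelope φ) x := by
  apply le_antisymm
  · refine le_iInf fun y => ?_
    by_cases ht : θ (x - y) = ∞
    · rw [ht, EReal.coe_ennreal_top, EReal.coe_add_top]
      exact le_top
    rw [← EReal.coe_ennreal_toReal ht, ← EReal.coe_add]
    refine le_of_forall_gt fun w hw => ?_
    obtain ⟨c, hc, hcw⟩ := EReal.lt_iff_exists_real_btwn.1 hw
    rw [EReal.coe_lt_coe_iff] at hc
    obtain ⟨p, hp, hpy, hpc⟩ := exists_integral_lt_of_convexEnvelope_lt (lt_sub_iff_add_lt.2 hc)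
    refine lt_of_le_of_lt (iInf₂_le p hp) (lt_of_le_of_lt ?_ hcw)
    rw [hpy, ← EReal.coe_ennreal_toReal ht, ← EReal.coe_add, EReal.coe_le_coe_iff]
    linarith
  · refine le_iInf₂ fun p hp => (iInf_le _ (∫ x, x ∂p)).trans ?_
    exact add_le_add (EReal.coe_le_coe_iff.2 (convexEnvelope_le_integral hφ hp)) le_rfl

end Envelope

/-! ### Measurability of the cost and of the infimum operators -/

section Measurability

variable {E : Type*} [NormedAddCommGroup E] [NormedSpace ℝ E]

/-- A finite convex function is continuous. -/
lemma continuous_of_convexOn_of_ne_top [FiniteDimensional ℝ E] {θ : E → ℝ≥0∞}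
    (hθ : ConvexOn ℝ≥0 univ θ) (hfin : ∀ x, θ x ≠ ∞) : Continuous θ := by
  have h1 : ConvexOn ℝ univ fun x => (θ x).toReal := by
    refine ⟨convex_univ, fun x _ y _ a b ha hb hab => ?_⟩
    lift a to ℝ≥0 using ha
    lift b to ℝ≥0 using hb
    have h := hθ.2 (mem_univ x) (mem_univ y) (zero_le (a := a)) (zero_le (a := b))
      (by exact_mod_cast hab)
    have ha' : a • θ x ≠ ∞ := by
      rw [ENNReal.smul_def, smul_eq_mul]
      exact ENNReal.mul_ne_top ENNReal.coe_ne_top (hfin x)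
    have hb' : b • θ y ≠ ∞ := by
      rw [ENNReal.smul_def, smul_eq_mul]
      exact ENNReal.mul_ne_top ENNReal.coe_ne_top (hfin y)
    have h2 := ENNReal.toReal_mono (ENNReal.add_ne_top.2 ⟨ha', hb'⟩) h
    rw [ENNReal.toReal_add ha' hb', ENNReal.toReal_smul, ENNReal.toReal_smul] at h2
    exact h2
  have h2 := ENNReal.continuous_ofReal.comp (continuous_of_convexOn_univ h1)
  convert h2 using 1
  ext x
  simp [ENNReal.ofReal_toReal (hfin x)]

lemma continuous_coe_add_coe_ennreal {Z : Type*} [TopologicalSpace Z] {f : Z → ℝ}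
    (hf : Continuous f) {g : Z → ℝ≥0∞} (hg : Continuous g) :
    Continuous fun z => (f z : EReal) + (g z : EReal) := by
  rw [continuous_iff_continuousAt]
  intro z
  exact (EReal.continuousAt_add (p := ((f z : EReal), (g z : EReal)))
    (Or.inl (EReal.coe_ne_top _)) (Or.inl (EReal.coe_ne_bot _))).comp
    (f := fun z => ((f z : EReal), (g z : EReal)))
    ((continuous_coe_real_ereal.comp hf).prodMk
      (continuous_coe_ennreal_ereal.comp hg)).continuousAt

lemma lowerSemicontinuous_coe_add_coe_ennreal {Z : Type*} [TopologicalSpace Z] {f : Z → ℝ}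
    (hf : Continuous f) {g : Z → ℝ≥0∞} (hg : LowerSemicontinuous g) :
    LowerSemicontinuous fun z => (f z : EReal) + (g z : EReal) := by
  refine LowerSemicontinuous.add' (continuous_coe_real_ereal.comp hf).lowerSemicontinuous
    (continuous_coe_ennreal_ereal.comp_lowerSemicontinuous hg
      fun a b h => EReal.coe_ennreal_le_coe_ennreal_iff.2 h) fun z => ?_
  exact EReal.continuousAt_add (Or.inl (EReal.coe_ne_top _)) (Or.inl (EReal.coe_ne_bot _))

/-- By the tube lemma, `G > d` on `{z} × P` persists nearby. The level `d` above `c` restores the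
strict inequality lost in the infimum. -/
lemma lowerSemicontinuous_iInf_of_compactSpace {Z P : Type*} [TopologicalSpace Z]
    [TopologicalSpace P] [CompactSpace P] {G : Z × P → EReal} (hG : LowerSemicontinuous G) :
    LowerSemicontinuous fun z => ⨅ p, G (z, p) := by
  intro z c hc
  obtain ⟨d, hcd, hd⟩ := exists_between hc
  obtain ⟨U, V, hU, -, hzU, hV, hUV⟩ := generalized_tube_lemma (isCompact_singleton (x := z))
    (isCompact_univ (X := P)) (hG.isOpen_preimage d) (by
      rintro ⟨z', p⟩ ⟨hz', -⟩
      obtain rfl : z' = z := hz'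
      exact hd.trans_le (iInf_le _ p))
  filter_upwards [hU.mem_nhds (hzU rfl)] with z' hz'
  refine hcd.trans_le (le_iInf fun p => ?_)
  have : (z', p) ∈ G ⁻¹' Ioi d := hUV ⟨hz', hV (mem_univ p)⟩
  exact le_of_lt this

variable [MeasurableSpace E] [BorelSpace E]

omit [NormedSpace ℝ E] in
-- The substitution `v = x - y` moves `x` into the continuous function `g`, so `Q θ g` is an infimum
-- of continuous functions, hence upper semicontinuous.
lemma measurable_Q (θ : E → ℝ≥0∞) {g : E → ℝ} (hg : Continuous g) : Measurable (Q θ g) := by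
  have h1 : Q θ g = fun x => ⨅ v, ((g (x - v) : EReal) + (θ v : EReal)) := by
    ext x
    rw [← (Equiv.subLeft x).iInf_comp]
    simp [Q]
  rw [h1]
  refine UpperSemicontinuous.measurable (upperSemicontinuous_iInf fun v => ?_)
  exact (continuous_coe_add_coe_ennreal (hg.comp (continuous_id.sub continuous_const))
    continuous_const).upperSemicontinuous

lemma measurable_barQOn_of_continuous (X : Set E) {θ : E → ℝ≥0∞} (hθ : Continuous θ) (φ : X → ℝ) :
    Measurable (barQOn X θ φ) := by
  refine UpperSemicontinuous.measurable (upperSemicontinuous_biInf fun p _ => ?_)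
  exact (continuous_coe_add_coe_ennreal continuous_const
    (hθ.comp (continuous_id.sub continuous_const))).upperSemicontinuous

variable [FiniteDimensional ℝ E]

lemma continuous_barycenter (X : Set E) [CompactSpace X] :
    Continuous fun p : ProbabilityMeasure X => ∫ y, (y : E) ∂(p : Measure X) := by
  have : ProperSpace E := FiniteDimensional.proper ℝ E
  let e : E ≃L[ℝ] (Fin (Module.finrank ℝ E) → ℝ) := (Module.finBasis ℝ E).equivFunL
  have h1 : Continuous fun p : ProbabilityMeasure X => e (∫ y, (y : E) ∂(p : Measure X)) := by
    refine continuous_pi fun i => ?_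
    let f : C(X, ℝ) := ⟨fun y => e (y : E) i, by fun_prop⟩
    refine (ProbabilityMeasure.continuous_integral_continuousMap f).congr fun p => ?_
    have hi : Integrable (fun y : X => (y : E)) (p : Measure X) := by
      obtain ⟨C, hC⟩ := (isCompact_range (continuous_subtype_val (p := (· ∈ X)))).isBounded.exists_norm_le
      exact (integrable_const C).mono' continuous_subtype_val.measurable.aestronglyMeasurable
        (ae_of_all _ fun y => hC _ ⟨y, rfl⟩)
    exact ((ContinuousLinearMap.proj (R := ℝ) (φ := fun _ => ℝ) i).comp
      (e : E →L[ℝ] _)).integral_comp_comm hi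
  have h2 := e.symm.continuous.comp h1
  refine h2.congr fun p => ?_
  simp

/-- On compact `X` all probability measures have a first moment and form a weakly compact space on
which the barycenter is continuous. The infimum is then lower semicontinuous in `x`. -/
lemma measurable_barQOn_of_isCompact {X : Set E} (hX : IsCompact X) {θ : E → ℝ≥0∞}
    (hθ : LowerSemicontinuous θ) {φ : X → ℝ} (hφ : Continuous φ) : Measurable (barQOn X θ φ) := by
  have : CompactSpace X := isCompact_iff_compactSpace.1 hX
  have h1 : barQOn X θ φ = fun x => ⨅ p : ProbabilityMeasure X,
      (((∫ y, φ y ∂(p : Measure X) : ℝ) : EReal) +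
        (θ (x - ∫ y, (y : E) ∂(p : Measure X)) : EReal)) := by
    ext x
    apply le_antisymm
    · refine le_iInf fun p => iInf₂_le (p : Measure X) ⟨inferInstance, ?_⟩
      obtain ⟨x₀⟩ : Nonempty X := p.nonempty
      refine ⟨x₀, lt_of_le_of_lt (lintegral_mono fun y =>
        Metric.edist_le_ediam_of_mem (mem_univ y) (mem_univ x₀)) ?_⟩
      simpa using (isCompact_univ (X := X)).isBounded.ediam_ne_top.lt_top
    · exact le_iInf₂ fun p hp => iInf_le (fun p : ProbabilityMeasure X =>
        (((∫ y, φ y ∂(p : Measure X) : ℝ) : EReal) +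
        (θ (x - ∫ y, (y : E) ∂(p : Measure X)) : EReal))) ⟨p, hp.1⟩
  rw [h1]
  refine (lowerSemicontinuous_iInf_of_compactSpace (Z := E) (P := ProbabilityMeasure X)
    (G := fun q => ((∫ y, φ y ∂(q.2 : Measure X) : ℝ) : EReal) +
        (θ (q.1 - ∫ y, (y : E) ∂(q.2 : Measure X)) : EReal)) ?_).measurable
  refine lowerSemicontinuous_coe_add_coe_ennreal ?_ ?_
  · exact (ProbabilityMeasure.continuous_integral_continuousMap (⟨φ, hφ⟩ : C(X, ℝ))).comp
      continuous_snd
  · exact hθ.comp (continuous_fst.sub ((continuous_barycenter X).comp continuous_snd))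

lemma isCost_barCost (X : Set E) {θ : E → ℝ≥0∞} (hθ : Measurable θ) : IsCost (barCost X θ) := by
  have : ProperSpace E := FiniteDimensional.proper ℝ E
  -- The inclusion of `P1 X` into measures is itself a kernel, so measurability of the barycenter is
  -- measurability of a kernel integral.
  let κ : Kernel {p : Measure X // p ∈ P1 X} X := ⟨Subtype.val, measurable_subtype_coe⟩
  have h1 : Measurable fun p : {p : Measure X // p ∈ P1 X} => ∫ y, (y : E) ∂p.1 :=
    (StronglyMeasurable.integral_kernel (κ := κ)
      continuous_subtype_val.stronglyMeasurable).measurable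
  exact hθ.comp ((measurable_subtype_coe.comp measurable_fst).sub (h1.comp measurable_snd))

end Measurability

/-! ### Weak duality and the comparison with convex test functions -/

section WeakDuality

variable {E : Type*} [NormedAddCommGroup E] [NormedSpace ℝ E] [FiniteDimensional ℝ E]
  [MeasurableSpace E] [BorelSpace E] {X : Set E} {θ : E → ℝ≥0∞} {μ ν : Measure X}

/-- The first moment of `ν` disintegrates along `p`, so almost every `p x` lies in `P1 X` and is
admissible in the infimum. -/
lemma eintegral_barQOn_le (hθ : Measurable θ) (hμ : μ ∈ P1 X) (hν : ν ∈ P1 X)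
    {φ : X → ℝ} (hφ : φ ∈ Phi1b X) {p : Kernel X X} [IsMarkovKernel p]
    (hp : (μ ⊗ₘ p).map Prod.snd = ν) :
    eintegral μ (fun x : X => barQOn X θ φ x) ≤
      ((∫ y, φ y ∂ν : ℝ) : EReal) + ((∫⁻ x, barCost X θ x (p x) ∂μ : ℝ≥0∞) : EReal) := by
  have : ProperSpace E := FiniteDimensional.proper ℝ E
  have := hμ.1
  obtain ⟨x₀⟩ := nonempty_of_mem_P1 hμ
  have hφi : Integrable (fun q : X × X => φ q.2) (μ ⊗ₘ p) := by
    have h1 := integrable_of_mem_Phi1b hν hφ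
    rw [← hp] at h1
    exact h1.comp_measurable measurable_snd
  have hdi : Integrable (fun q : X × X => dist q.2 x₀) (μ ⊗ₘ p) := by
    have h1 := integrable_dist_of_mem_P1 hν x₀
    rw [← hp] at h1
    exact h1.comp_measurable measurable_snd
  have hφν : ∫ y, φ y ∂ν = ∫ x, ∫ y, φ y ∂p x ∂μ := by
    rw [← hp, integral_map measurable_snd.aemeasurable hφ.1.measurable.aestronglyMeasurable,
      Measure.integral_compProd hφi]
  have hmean : Integrable (fun x => ∫ y, φ y ∂p x) μ := by
    refine ((Measure.integrable_compProd_iff hφi.1).1 hφi).2.mono'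
      (StronglyMeasurable.integral_kernel hφ.1.measurable.stronglyMeasurable).aestronglyMeasurable
      (ae_of_all _ fun x => ?_)
    exact norm_integral_le_integral_norm _
  have hcost : Measurable fun x => barCost X θ x (p x) :=
    hθ.comp (continuous_subtype_val.measurable.sub
      (StronglyMeasurable.integral_kernel continuous_subtype_val.stronglyMeasurable).measurable)
  rw [hφν]
  refine eintegral_le_of_le_add hmean hcost.aemeasurable ?_
  filter_upwards [((Measure.integrable_compProd_iff hdi.1).1 hdi).1] with x hx
  exact iInf₂_le (p x) (mem_P1_of_integrable_dist hx)

/-- Weak duality for the barycentric transport cost. -/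
theorem eintegral_barQOn_sub_le (hθ : Measurable θ) (hμ : μ ∈ P1 X) (hν : ν ∈ P1 X)
    {φ : X → ℝ} (hφ : φ ∈ Phi1b X) :
    eintegral μ (fun x : X => barQOn X θ φ x) - ((∫ y, φ y ∂ν : ℝ) : EReal) ≤
      (transportCost (barCost X θ) ν μ : EReal) := by
  set I := eintegral μ (fun x : X => barQOn X θ φ x) - ((∫ y, φ y ∂ν : ℝ) : EReal) with hI
  -- The infimum over couplings is taken in `ℝ≥0∞`, so the bound is proved for the positive part of
  -- `I`.
  have key : I.toENNReal ≤ transportCost (barCost X θ) ν μ := by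
    refine le_iInf₂ fun π hπ => le_iInf fun p => le_iInf fun hp => le_iInf fun hdis => ?_
    obtain ⟨hπp, hπ1, hπ2⟩ := hπ
    rw [hπ1] at hdis ⊢
    have h1 := eintegral_barQOn_le hθ hμ hν hφ (p := p) (by rw [hdis, hπ2])
    have h2 : I ≤ ((∫⁻ x, barCost X θ x (p x) ∂μ : ℝ≥0∞) : EReal) := by
      refine (EReal.sub_le_iff_le_add (Or.inl (EReal.coe_ne_bot _))
        (Or.inl (EReal.coe_ne_top _))).2 ?_
      rwa [add_comm]
    simpa using EReal.toENNReal_le_toENNReal h2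
  calc I ≤ max 0 I := le_max_right _ _
    _ = (I.toENNReal : EReal) := EReal.coe_toENNReal_eq_max.symm
    _ ≤ _ := EReal.coe_ennreal_le_coe_ennreal_iff.2 key

omit [FiniteDimensional ℝ E] in
lemma le_barQOn {φ : X → ℝ} (hφ : φ ∈ Phi1b X) {m : ℝ} (hm : ∀ x, m ≤ φ x) (x : E) :
    (m : EReal) ≤ barQOn X θ φ x := by
  refine le_iInf₂ fun p hp => coe_le_coe_add_ennreal fun _ => ?_
  have := hp.1
  have h1 := integral_mono (integrable_const m) (integrable_of_mem_Phi1b hp hφ) hm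
  have h2 : m ≤ ∫ y, φ y ∂p := by simpa using h1
  have h3 : 0 ≤ (θ (x - ∫ y, (y : E) ∂p)).toReal := ENNReal.toReal_nonneg
  linarith

/-- The barycenter of `p` is a competitor in `Q`, with a smaller value of `φ` by Jensen. -/
lemma Q_le_barQOn {φ : E → ℝ} (hφ : φ ∈ convexLipschitzBelow E) (x : E) :
    Q θ φ x ≤ barQOn X θ (fun y : X => φ y) x := by
  have : ProperSpace E := FiniteDimensional.proper ℝ E
  refine le_iInf₂ fun p hp => (iInf_le _ (∫ y, (y : E) ∂p)).trans ?_
  have := hp.1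
  refine add_le_add (EReal.coe_le_coe_iff.2 ?_) le_rfl
  exact map_integral_le_of_convexOn (integrable_coe_of_mem_P1 hp) hφ.1
    (integrable_of_mem_Phi1b hp (restrict_mem_Phi1b (convexLipschitzBelow_subset_Phi1b hφ)
      (nonempty_of_mem_P1 hp))) fun _ => le_rfl

/-- Strong duality with convex Lipschitz functions. -/
theorem transportCost_le_iSup_convexLipschitzBelow (hX : IsClosed X) (hθ : ConvexOn ℝ≥0 univ θ)
    (hl : LowerSemicontinuous θ) (hμ : μ ∈ P1 X) (hν : ν ∈ P1 X) :
    (transportCost (barCost X θ) ν μ : EReal) ≤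
      ⨆ φ ∈ convexLipschitzBelow E, (eintegral μ (fun x : X => Q θ φ x) -
        ((∫ y : X, φ y ∂ν : ℝ) : EReal)) := by
  refine le_of_forall_gt fun w hw => ?_
  obtain ⟨D, hD, hDw⟩ := EReal.lt_iff_exists_real_btwn.1 hw
  refine lt_of_le_of_lt ?_ hDw
  have hdual : ∀ φ ∈ convexLipschitzBelow E, ∀ f : X → ℝ, Integrable f μ →
      (∀ x : X, (f x : EReal) ≤ Q θ φ x) → ∫ x, f x ∂μ ≤ D + ∫ y : X, φ y ∂ν := by
    intro φ hφ f hf hfQ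
    have h1 : eintegral μ (fun x : X => Q θ φ x) - ((∫ y : X, φ y ∂ν : ℝ) : EReal) ≤ D :=
      (le_iSup₂ (f := fun φ (_ : φ ∈ convexLipschitzBelow E) =>
        eintegral μ (fun x : X => Q θ φ x) - ((∫ y : X, φ y ∂ν : ℝ) : EReal)) φ hφ).trans hD.le
    have h2 := (EReal.sub_le_iff_le_add (Or.inl (EReal.coe_ne_bot _))
      (Or.inl (EReal.coe_ne_top _))).1 h1
    have h3 := (eintegral_mono hfQ).trans h2
    rw [eintegral_coe hf, ← EReal.coe_add, EReal.coe_le_coe_iff] at h3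
    exact h3
  have hD0 : 0 ≤ D := by
    have := hdual 0 ⟨convexOn_const 0 convex_univ, ⟨0, LipschitzWith.const 0⟩, ⟨0, by
      rintro _ ⟨x, rfl⟩; exact le_rfl⟩⟩ 0 (integrable_zero _ _ _) fun x =>
        le_iInf fun y => coe_le_coe_add_ennreal fun _ => by simp
    simpa using this
  have h := EReal.coe_ennreal_le_coe_ennreal_iff.2
    (transportCost_barCost_le hX hθ hl hμ hν hdual)
  rwa [EReal.coe_ennreal_ofReal, max_eq_left hD0] at h

end WeakDuality

end BarTransport

/-! ### Assembly of the duality formulas -/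

theorem theorem2 {E : Type*} [NormedAddCommGroup E] [NormedSpace ℝ E] [FiniteDimensional ℝ E]
    [MeasurableSpace E] [BorelSpace E]
    (X : Set E) (hX : IsClosed X)
    (θ : E → ℝ≥0∞) (hθ : ConvexOn ℝ≥0 Set.univ θ)
    (h : ((∀ x, θ x ≠ ∞) ∧ ∃ a b : ℝ, 0 < a ∧ ∀ x, a * ‖x‖ + b ≤ (θ x).toReal) ∨
      (LowerSemicontinuous θ ∧ (IsCompact X ∨ (X.Countable ∧ DiscreteTopology X)))) :
    -- duality holds for the barycentric cost
    DualityHolds (barCost X θ) ∧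
    -- (1), on `X`
    (∀ φ ∈ Phi1b X, Measurable fun x : X => barQOn X θ φ x) ∧
    (∀ μ ∈ P1 X, ∀ ν ∈ P1 X,
      (transportCost (barCost X θ) ν μ : EReal) =
        ⨆ φ ∈ Phi1b X, (eintegral μ (fun x : X => barQOn X θ φ x) -
          ((∫ y, φ y ∂ν : ℝ) : EReal))) ∧
    -- (1), with functions and measures on the whole space
    (∀ φ ∈ Phi1b E, Measurable fun x : X => barQ θ φ x) ∧
    (∀ μ ∈ P1 X, ∀ ν ∈ P1 X,
      (transportCost (barCost X θ) ν μ : EReal) =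
        ⨆ φ ∈ Phi1b E, (eintegral μ (fun x : X => barQ θ φ x) -
          ((∫ y : X, φ y ∂ν : ℝ) : EReal))) ∧
    -- (2)
    (∀ φ ∈ Phi1b E, ∃ φc ∈ Phi1b E, IsConvexEnvelope φ φc ∧ ∀ x, barQ θ φ x = Q θ φc x) ∧
    -- (3)
    (∀ φ ∈ convexLipschitzBelow E, Measurable fun x : X => Q θ φ x) ∧
    (∀ μ ∈ P1 X, ∀ ν ∈ P1 X,
      (transportCost (barCost X θ) ν μ : EReal) =
        ⨆ φ ∈ convexLipschitzBelow E, (eintegral μ (fun x : X => Q θ φ x) -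
          ((∫ y : X, φ y ∂ν : ℝ) : EReal))) := by
  have hproper : ProperSpace E := FiniteDimensional.proper ℝ E
  have hl : LowerSemicontinuous θ := by
    rcases h with ⟨hfin, -⟩ | ⟨hl, -⟩
    · exact (continuous_of_convexOn_of_ne_top hθ hfin).lowerSemicontinuous
    · exact hl
  -- `barQOn` is upper semicontinuous when `θ` is finite, lower semicontinuous when `X` is compact,
  -- and trivially measurable on a countable `X`.
  have hbarQOn : ∀ φ ∈ Phi1b X, Measurable fun x : X => barQOn X θ φ x := by
    intro φ hφ
    rcases h with ⟨hfin, -⟩ | ⟨-, hXc | ⟨hXc, -⟩⟩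
    · exact (measurable_barQOn_of_continuous X (continuous_of_convexOn_of_ne_top hθ hfin) φ).comp
        measurable_subtype_coe
    · exact (measurable_barQOn_of_isCompact hXc hl hφ.1).comp measurable_subtype_coe
    · have : Countable X := hXc
      exact measurable_of_countable _
  have hQ : ∀ φ ∈ convexLipschitzBelow E, Measurable fun x : X => Q θ φ x := fun φ hφ =>
    (measurable_Q θ (convexLipschitzBelow_subset_Phi1b hφ).1).comp measurable_subtype_coe
  have hT_le : ∀ μ ∈ P1 X, ∀ ν ∈ P1 X, (transportCost (barCost X θ) ν μ : EReal) ≤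
      ⨆ φ ∈ convexLipschitzBelow E, (eintegral μ (fun x : X => Q θ φ x) -
        ((∫ y : X, φ y ∂ν : ℝ) : EReal)) := fun μ hμ ν hν =>
    transportCost_le_iSup_convexLipschitzBelow hX hθ hl hμ hν
  have hQ_le : ∀ μ ∈ P1 X, ∀ ν ∈ P1 X, (⨆ φ ∈ convexLipschitzBelow E,
      (eintegral μ (fun x : X => Q θ φ x) - ((∫ y : X, φ y ∂ν : ℝ) : EReal))) ≤
      ⨆ φ ∈ Phi1b X, (eintegral μ (fun x : X => barQOn X θ φ x) -
          ((∫ y, φ y ∂ν : ℝ) : EReal)) := fun μ hμ ν _ => iSup₂_le fun φ hφ =>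
    le_iSup₂_of_le (fun y : X => φ y) (restrict_mem_Phi1b (convexLipschitzBelow_subset_Phi1b hφ)
      (nonempty_of_mem_P1 hμ)) (EReal.sub_le_sub (eintegral_mono fun x => Q_le_barQOn hφ x) le_rfl)
  have hle_T : ∀ μ ∈ P1 X, ∀ ν ∈ P1 X, (⨆ φ ∈ Phi1b X,
      (eintegral μ (fun x : X => barQOn X θ φ x) - ((∫ y, φ y ∂ν : ℝ) : EReal))) ≤
      (transportCost (barCost X θ) ν μ : EReal) := fun μ hμ ν hν =>
    iSup₂_le fun φ hφ => eintegral_barQOn_sub_le hl.measurable hμ hν hφ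
  have hdual : ∀ μ ∈ P1 X, ∀ ν ∈ P1 X, (transportCost (barCost X θ) ν μ : EReal) =
      ⨆ φ ∈ Phi1b X, (eintegral μ (fun x : X => barQOn X θ φ x) -
          ((∫ y, φ y ∂ν : ℝ) : EReal)) := fun μ hμ ν hν =>
    le_antisymm ((hT_le μ hμ ν hν).trans (hQ_le μ hμ ν hν)) (hle_T μ hμ ν hν)
  have hdualQ : ∀ μ ∈ P1 X, ∀ ν ∈ P1 X, (transportCost (barCost X θ) ν μ : EReal) =
      ⨆ φ ∈ convexLipschitzBelow E, (eintegral μ (fun x : X => Q θ φ x) -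
        ((∫ y : X, φ y ∂ν : ℝ) : EReal)) := fun μ hμ ν hν =>
    le_antisymm (hT_le μ hμ ν hν) ((hQ_le μ hμ ν hν).trans (hle_T μ hμ ν hν))
  have hbarQ : ∀ φ ∈ Phi1b E, barQ θ φ = Q θ (convexEnvelope φ) := fun φ hφ =>
    funext (barQ_eq_Q θ hφ)
  refine ⟨⟨isCost_barCost X hl.measurable, fun μ hμ ν hν => ?_⟩, hbarQOn, hdual, fun φ hφ => ?_,
    fun μ hμ ν hν => ?_, fun φ hφ => ?_, hQ, hdualQ⟩
  · rw [hdual μ hμ ν hν]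
    refine iSup_congr fun φ => iSup_congr fun hφ => ?_
    have := hμ.1
    obtain ⟨m, hm⟩ := hφ.2.2
    exact congrArg (· - _) (innerIntegral_eq_eintegral (hbarQOn φ hφ)
      fun x => le_barQOn hφ (fun y => hm ⟨y, rfl⟩) x).symm
  · rw [hbarQ φ hφ]
    exact hQ _ (convexEnvelope_mem hφ)
  · rw [hdualQ μ hμ ν hν]
    -- A convex Lipschitz function is its own envelope, which gives one bound. For the other,
    -- replacing `φ` by its envelope leaves `barQ` unchanged and does not increase the integral
    -- against `ν`.
    apply le_antisymm
    · refine iSup₂_le fun φ hφ => le_iSup₂_of_le φ (convexLipschitzBelow_subset_Phi1b hφ) ?_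
      rw [hbarQ φ (convexLipschitzBelow_subset_Phi1b hφ), convexEnvelope_eq_self hφ]
    · refine iSup₂_le fun φ hφ => le_iSup₂_of_le _ (convexEnvelope_mem hφ) ?_
      rw [hbarQ φ hφ]
      have hX0 := nonempty_of_mem_P1 hμ
      refine EReal.sub_le_sub le_rfl (EReal.coe_le_coe_iff.2 (integral_mono ?_ ?_
        fun y => convexEnvelope_le hφ y))
      · exact integrable_of_mem_Phi1b hν (restrict_mem_Phi1b
          (convexLipschitzBelow_subset_Phi1b (convexEnvelope_mem hφ)) hX0)
      · exact integrable_of_mem_Phi1b hν (restrict_mem_Phi1b hφ hX0)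
  · exact ⟨convexEnvelope φ, convexLipschitzBelow_subset_Phi1b (convexEnvelope_mem hφ),
      isConvexEnvelope_convexEnvelope hφ, fun x => barQ_eq_Q θ hφ x⟩
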